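/- Let $k$ be a field, $H$ a Hopf algebra over $k$ (with coproduct $\Delta$, antipode $S$), and let $A$ be a right $H$-comodule algebra with coaction $\Delta_A:A\to A\otimes H$, $\Delta_A(a)=a_0\otimes a_1$. Put $B=A^{\mathrm{co}H}=\{a\in A:\Delta_A(a)=a\otimes 1\}$ and assume that $B\subseteq A$ is a faithfully flat Hopf–Galois extension, i.e. $A\otimes_BA\to A\otimes H$, $a\otimes a'\mapsto aa'_0\otimes a'_1$, is bijective and $A$ is a faithfully flat left $B$-module. Definitions. A first order differential calculus over an algebra $R$ is an $R$-bimodule $\Gamma$ with a derivation $\mathrm d:R\to\Gamma$ such that $\Gamma=\mathrm{span}\{r\,\mathrm dr'\}$; a differential calculus over $R$ is a differential $\mathbb N_0$-graded algebra $\Omega^\bullet(R)$ with $\Omega^0(R)=R$ and $\Omega^n(R)=\mathrm{span}\{r^0\mathrm dr^1\wedge\dots\wedge\mathrm dr^n\}$. The maximal prolongation of $\Gamma$ is the tensor algebra of the bimodule $\Gamma$ over $R$ modulo the ideal generated by all $\sum_i\mathrm dr_i\otimes_R\mathrm ds_i$ with $\sum_i r_i\,\mathrm ds_i=0$. * A pair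 $(\Gamma_A,\Gamma_H)$ of a right $H$-covariant first order calculus over $A$ and a bicovariant first order calculus over $H$ is a Brzeziński–Majid quantum principal bundle if, with $\Lambda^1\subseteq\Gamma_H$ the space of left coinvariant forms and $\varpi(h)=S(h_1)\,\mathrm dh_2$, the map $\mathfrak{ver}_{BM}:\Gamma_A\to A\otimes\Lambda^1$, $a\,\mathrm da'\mapsto aa'_0\otimes\varpi(a'_1)$, is well defined and $0\to A\,\mathrm d(B)\,A\to\Gamma_A\xrightarrow{\mathfrak{ver}_{BM}}A\otimes\Lambda^1\to0$ is exact. The elements of $A\,\mathrm d(B)\,A$ are the Brzeziński–Majid horizontal forms. * Given a differential calculus $\Omega^\bullet(H)$ over $H$, a differential calculus $\Omega^\bullet(A)$ over $A$ is first order complete if $\Delta_A$ extends to a morphism of first order differential calculi $\Delta_A^1:\Omega^1(A)\to\Omega^1(A\otimes H):=(\Omega^1(A)\otimes H)\oplus(A\otimes\Omega^1(H))$, where $A\otimes H$ carries the differential $\mathrm d\otimes\mathrm{id}+\mathrm{id}\otimes\mathrm d$. Such a $\Delta^1_A$ is unique, and Đurđević's horizontal $1$-forms are $\mathfrak{hor}^1(A)=(\Delta_A^1)^{-1}(\Omega^1(A)\otimes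 H)$. Proposition. 1. If $(\Gamma_A,\Gamma_H)$ is a Brzeziński–Majid quantum principal bundle, then the maximal prolongation of $\Gamma_A$ is first order complete with respect to the maximal prolongation of $\Gamma_H$. 2. Let $\Omega^\bullet(H)$ be a differential calculus over $H$ whose first order part is bicovariant, and let $\Omega^\bullet(A)$ be a differential calculus over $A$ that is first order complete with respect to $\Omega^\bullet(H)$. Then $(\Omega^1(A),\Omega^1(H))$ is a Brzeziński–Majid quantum principal bundle if and only if $A\,\mathrm d(B)\,A=\mathfrak{hor}^1(A)$. -/

import Mathlib

open scoped TensorProduct DirectSum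
open MulOpposite (op)

universe u₀ u₁ u₂ u₃ u₄

namespace QPB

/-! ### First order differential calculi -/

/-- A first order differential calculus over a `k`-algebra `A`: an `A`-bimodule `Form` with a
derivation `d : A → Form` such that `Form` is spanned by the elements `a • d b`. The right action
of `a` on `ω` is written `op a • ω`. -/
structure FODC (k : Type u₀) (A : Type u₁) [Field k] [Ring A] [Algebra k A] where
  Form : Type u₂
  [addCommGroup : AddCommGroup Form]
  [moduleBase : Module k Form]
  [moduleLeft : Module A Form]
  [moduleRight : Module Aᵐᵒᵖ Form]
  [smulComm : SMulCommClass A Aᵐᵒᵖ Form]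
  [towerLeft : IsScalarTower k A Form]
  [towerRight : IsScalarTower k Aᵐᵒᵖ Form]
  d : A →ₗ[k] Form
  leibniz : ∀ a b : A, d (a * b) = op b • d a + a • d b
  span_eq_top : Submodule.span k {ω : Form | ∃ a b : A, ω = a • d b} = ⊤

attribute [instance] FODC.addCommGroup FODC.moduleBase FODC.moduleLeft FODC.moduleRight
  FODC.smulComm FODC.towerLeft FODC.towerRight

/-- A morphism `(Φ, φ)` of first order differential calculi, for a given algebra map `φ`. -/
structure FODC.Hom {k : Type u₀} [Field k] {A : Type u₁} [Ring A] [Algebra k A]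
    {A' : Type u₂} [Ring A'] [Algebra k A'] (Γ : FODC.{u₀, u₁, u₃} k A)
    (Γ' : FODC.{u₀, u₂, u₄} k A') (φ : A →ₐ[k] A') where
  toLinearMap : Γ.Form →ₗ[k] Γ'.Form
  map_bimodule : ∀ (a b : A) (ω : Γ.Form),
    toLinearMap (a • op b • ω) = φ a • op (φ b) • toLinearMap ω
  map_d : ∀ a : A, toLinearMap (Γ.d a) = Γ'.d (φ a)

section Tensor

variable (k : Type u₀) [Field k] (A : Type*) [Ring A] [Algebra k A] (B : Type*) [Ring B]
  [Algebra k B]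

/-- The left action of `A ⊗ B` on `M ⊗ N`, for a left `A`-module `M` and a left `B`-module `N`:
`(a ⊗ b) · (m ⊗ n) = a m ⊗ b n`. -/
noncomputable def tensorLeftAct (M N : Type*) [AddCommGroup M] [Module k M] [Module A M]
    [IsScalarTower k A M] [AddCommGroup N] [Module k N] [Module B N] [IsScalarTower k B N] :
    A ⊗[k] B →ₐ[k] Module.End k (M ⊗[k] N) :=
  Module.endTensorEndAlgHom.comp
    (Algebra.TensorProduct.map (Algebra.lsmul k k M) (Algebra.lsmul k k N))

/-- The right action of `A ⊗ B` on `M ⊗ N`, for a right `A`-module `M` and a right `B`-module `N`: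
`(m ⊗ n) · (a ⊗ b) = m a ⊗ n b`. -/
noncomputable def tensorRightAct (M N : Type*) [AddCommGroup M] [Module k M] [Module Aᵐᵒᵖ M]
    [IsScalarTower k Aᵐᵒᵖ M] [AddCommGroup N] [Module k N] [Module Bᵐᵒᵖ N]
    [IsScalarTower k Bᵐᵒᵖ N] :
    (A ⊗[k] B)ᵐᵒᵖ →ₐ[k] Module.End k (M ⊗[k] N) :=
  (tensorLeftAct k Aᵐᵒᵖ Bᵐᵒᵖ M N).comp
    (Algebra.TensorProduct.opAlgEquiv k k A B).symm.toAlgHom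

variable {k A B}

@[simp] theorem tensorLeftAct_tmul {M N : Type*} [AddCommGroup M] [Module k M] [Module A M]
    [IsScalarTower k A M] [AddCommGroup N] [Module k N] [Module B N] [IsScalarTower k B N]
    (a : A) (b : B) (m : M) (n : N) :
    tensorLeftAct k A B M N (a ⊗ₜ b) (m ⊗ₜ n) = (a • m) ⊗ₜ (b • n) := rfl

@[simp] theorem tensorRightAct_tmul {M N : Type*} [AddCommGroup M] [Module k M] [Module Aᵐᵒᵖ M]
    [IsScalarTower k Aᵐᵒᵖ M] [AddCommGroup N] [Module k N] [Module Bᵐᵒᵖ N]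
    [IsScalarTower k Bᵐᵒᵖ N] (a : A) (b : B) (m : M) (n : N) :
    tensorRightAct k A B M N (op (a ⊗ₜ b)) (m ⊗ₜ n) = (op a • m) ⊗ₜ (op b • n) := by
  simp [tensorRightAct]

theorem tensorAct_comm {M N : Type*} [AddCommGroup M] [Module k M] [Module A M]
    [Module Aᵐᵒᵖ M] [SMulCommClass A Aᵐᵒᵖ M] [IsScalarTower k A M] [IsScalarTower k Aᵐᵒᵖ M]
    [AddCommGroup N] [Module k N] [Module B N] [Module Bᵐᵒᵖ N] [SMulCommClass B Bᵐᵒᵖ N]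
    [IsScalarTower k B N] [IsScalarTower k Bᵐᵒᵖ N]
    (s t : A ⊗[k] B) (x : M ⊗[k] N) :
    tensorLeftAct k A B M N s (tensorRightAct k A B M N (op t) x) =
      tensorRightAct k A B M N (op t) (tensorLeftAct k A B M N s x) := by
  induction x with
  | zero => simp
  | add x y hx hy => simp only [map_add, hx, hy]
  | tmul m n =>
    induction s with
    | zero => simp
    | add x y hx hy => simp only [map_add, LinearMap.add_apply, hx, hy]
    | tmul a b =>
      induction t with
      | zero => simp
      | add x y hx hy => simp only [map_add, MulOpposite.op_add, LinearMap.add_apply, hx, hy]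
      | tmul a' b' => simp [smul_comm]

variable (ΓA : FODC.{u₀, _, u₃} k A) (ΓB : FODC.{u₀, _, u₄} k B)

/-- The space of one-forms of the tensor product calculus over `A ⊗ B`:
`(Ω¹(A) ⊗ B) ⊕ (A ⊗ Ω¹(B))`. -/
def TensorForm : Type _ := (ΓA.Form ⊗[k] B) × (A ⊗[k] ΓB.Form)

noncomputable instance : AddCommGroup (TensorForm ΓA ΓB) :=
  inferInstanceAs (AddCommGroup ((ΓA.Form ⊗[k] B) × (A ⊗[k] ΓB.Form)))

noncomputable instance : Module k (TensorForm ΓA ΓB) :=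
  inferInstanceAs (Module k ((ΓA.Form ⊗[k] B) × (A ⊗[k] ΓB.Form)))

/-- The componentwise left action of `A ⊗ B`. -/
noncomputable instance : Module (A ⊗[k] B) (TensorForm ΓA ΓB) where
  smul s x := (tensorLeftAct k A B ΓA.Form B s x.1, tensorLeftAct k A B A ΓB.Form s x.2)
  one_smul x := Prod.ext (LinearMap.congr_fun (map_one _) x.1)
    (LinearMap.congr_fun (map_one _) x.2)
  mul_smul s t x := Prod.ext (LinearMap.congr_fun (map_mul _ s t) x.1)
    (LinearMap.congr_fun (map_mul _ s t) x.2)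
  smul_zero _ := Prod.ext (map_zero _) (map_zero _)
  smul_add _ _ _ := Prod.ext (map_add _ _ _) (map_add _ _ _)
  add_smul s t x := Prod.ext (LinearMap.congr_fun (map_add _ s t) x.1)
    (LinearMap.congr_fun (map_add _ s t) x.2)
  zero_smul x := Prod.ext (LinearMap.congr_fun (map_zero _) x.1)
    (LinearMap.congr_fun (map_zero _) x.2)

/-- The componentwise right action of `A ⊗ B`. -/
noncomputable instance : Module (A ⊗[k] B)ᵐᵒᵖ (TensorForm ΓA ΓB) where
  smul s x := (tensorRightAct k A B ΓA.Form B s x.1, tensorRightAct k A B A ΓB.Form s x.2)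
  one_smul x := Prod.ext (LinearMap.congr_fun (map_one _) x.1)
    (LinearMap.congr_fun (map_one _) x.2)
  mul_smul s t x := Prod.ext (LinearMap.congr_fun (map_mul _ s t) x.1)
    (LinearMap.congr_fun (map_mul _ s t) x.2)
  smul_zero _ := Prod.ext (map_zero _) (map_zero _)
  smul_add _ _ _ := Prod.ext (map_add _ _ _) (map_add _ _ _)
  add_smul s t x := Prod.ext (LinearMap.congr_fun (map_add _ s t) x.1)
    (LinearMap.congr_fun (map_add _ s t) x.2)
  zero_smul x := Prod.ext (LinearMap.congr_fun (map_zero _) x.1)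
    (LinearMap.congr_fun (map_zero _) x.2)

theorem TensorForm.left_smul_def (s : A ⊗[k] B) (x : TensorForm ΓA ΓB) :
    s • x = (tensorLeftAct k A B ΓA.Form B s x.1, tensorLeftAct k A B A ΓB.Form s x.2) := rfl

theorem TensorForm.right_smul_def (s : (A ⊗[k] B)ᵐᵒᵖ) (x : TensorForm ΓA ΓB) :
    s • x = (tensorRightAct k A B ΓA.Form B s x.1, tensorRightAct k A B A ΓB.Form s x.2) := rfl

instance : SMulCommClass (A ⊗[k] B) (A ⊗[k] B)ᵐᵒᵖ (TensorForm ΓA ΓB) where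
  smul_comm s t x := Prod.ext (tensorAct_comm s t.unop x.1) (tensorAct_comm s t.unop x.2)

instance : IsScalarTower k (A ⊗[k] B) (TensorForm ΓA ΓB) where
  smul_assoc c s x := Prod.ext (LinearMap.congr_fun (map_smul _ c s) x.1)
    (LinearMap.congr_fun (map_smul _ c s) x.2)

instance : IsScalarTower k (A ⊗[k] B)ᵐᵒᵖ (TensorForm ΓA ΓB) where
  smul_assoc c s x := Prod.ext (LinearMap.congr_fun (map_smul _ c s) x.1)
    (LinearMap.congr_fun (map_smul _ c s) x.2)

/-- The differential `d ⊗ id + id ⊗ d` on `A ⊗ B`. -/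
noncomputable def tensorD : A ⊗[k] B →ₗ[k] TensorForm ΓA ΓB :=
  (LinearMap.prod (TensorProduct.map ΓA.d LinearMap.id) (TensorProduct.map LinearMap.id ΓB.d) :
    A ⊗[k] B →ₗ[k] (ΓA.Form ⊗[k] B) × (A ⊗[k] ΓB.Form))

theorem tensorD_tmul (a : A) (b : B) :
    tensorD ΓA ΓB (a ⊗ₜ b) = (ΓA.d a ⊗ₜ b, a ⊗ₜ ΓB.d b) := rfl

theorem tensorD_leibniz (s t : A ⊗[k] B) :
    tensorD ΓA ΓB (s * t) = op t • tensorD ΓA ΓB s + s • tensorD ΓA ΓB t := by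
  induction s with
  | zero => simp
  | add x y hx hy =>
    simp only [add_mul, map_add, hx, hy, smul_add, add_smul]
    abel
  | tmul a b =>
    induction t with
    | zero => rw [mul_zero, map_zero, MulOpposite.op_zero, zero_smul, smul_zero, add_zero]
    | add x y hx hy =>
      simp only [mul_add, map_add, hx, hy, smul_add, add_smul, MulOpposite.op_add]
      abel
    | tmul a' b' =>
      rw [Algebra.TensorProduct.tmul_mul_tmul]
      refine Prod.ext ?_ ?_
      · change ΓA.d (a * a') ⊗ₜ[k] (b * b') =
          tensorRightAct k A B ΓA.Form B (op (a' ⊗ₜ b')) (ΓA.d a ⊗ₜ[k] b) +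
            tensorLeftAct k A B ΓA.Form B (a ⊗ₜ b) (ΓA.d a' ⊗ₜ[k] b')
        simp [ΓA.leibniz, TensorProduct.add_tmul]
      · change (a * a') ⊗ₜ[k] ΓB.d (b * b') =
          tensorRightAct k A B A ΓB.Form (op (a' ⊗ₜ b')) (a ⊗ₜ[k] ΓB.d b) +
            tensorLeftAct k A B A ΓB.Form (a ⊗ₜ b) (a' ⊗ₜ[k] ΓB.d b')
        simp [ΓB.leibniz, TensorProduct.tmul_add]

theorem FODC.d_one (Γ : FODC.{u₀, _, u₃} k A) : Γ.d 1 = 0 := by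
  have h := Γ.leibniz 1 1
  simpa using h

theorem tensorForm_span :
    Submodule.span k {ω : TensorForm ΓA ΓB | ∃ s t : A ⊗[k] B, ω = s • tensorD ΓA ΓB t} = ⊤ := by
  set P := Submodule.span k
    {ω : TensorForm ΓA ΓB | ∃ s t : A ⊗[k] B, ω = s • tensorD ΓA ΓB t} with hP
  let i₁ : ΓA.Form ⊗[k] B →ₗ[k] TensorForm ΓA ΓB := LinearMap.inl k _ _
  let i₂ : A ⊗[k] ΓB.Form →ₗ[k] TensorForm ΓA ΓB := LinearMap.inr k _ _
  have h₁ : ∀ x, i₁ x ∈ P := by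
    intro x
    induction x with
    | zero => simp
    | add x y hx hy => rw [map_add]; exact P.add_mem hx hy
    | tmul ω b =>
      have hω : ω ∈ Submodule.span k {ω : ΓA.Form | ∃ a b : A, ω = a • ΓA.d b} := by
        rw [ΓA.span_eq_top]; trivial
      induction hω using Submodule.span_induction with
      | zero => simp
      | add x y _ _ hx hy => rw [TensorProduct.add_tmul, map_add]; exact P.add_mem hx hy
      | smul c x _ hx =>
        rw [← TensorProduct.smul_tmul', map_smul]; exact P.smul_mem c hx
      | mem x hx =>
        obtain ⟨a, a', rfl⟩ := hx
        refine Submodule.subset_span ⟨a ⊗ₜ b, a' ⊗ₜ 1, ?_⟩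
        refine Prod.ext ?_ ?_
        · change (a • ΓA.d a') ⊗ₜ[k] b = (a • ΓA.d a') ⊗ₜ[k] (b • (1 : B))
          simp
        · change (0 : A ⊗[k] ΓB.Form) = (a • a') ⊗ₜ[k] (b • ΓB.d 1)
          simp [ΓB.d_one]
  have h₂ : ∀ x, i₂ x ∈ P := by
    intro x
    induction x with
    | zero => simp
    | add x y hx hy => rw [map_add]; exact P.add_mem hx hy
    | tmul a ω =>
      have hω : ω ∈ Submodule.span k {ω : ΓB.Form | ∃ a b : B, ω = a • ΓB.d b} := by
        rw [ΓB.span_eq_top]; trivial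
      induction hω using Submodule.span_induction with
      | zero => simp
      | add x y _ _ hx hy => rw [TensorProduct.tmul_add, map_add]; exact P.add_mem hx hy
      | smul c x _ hx =>
        rw [TensorProduct.tmul_smul, map_smul]; exact P.smul_mem c hx
      | mem x hx =>
        obtain ⟨b, b', rfl⟩ := hx
        refine Submodule.subset_span ⟨a ⊗ₜ b, 1 ⊗ₜ b', ?_⟩
        refine Prod.ext ?_ ?_
        · change (0 : ΓA.Form ⊗[k] B) = (a • ΓA.d 1) ⊗ₜ[k] (b • b')
          simp [ΓA.d_one]
        · change a ⊗ₜ[k] (b • ΓB.d b') = (a • (1 : A)) ⊗ₜ[k] (b • ΓB.d b')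
          simp
  refine eq_top_iff.2 fun x _ => ?_
  have hx : x = i₁ x.1 + i₂ x.2 :=
    Prod.ext (add_zero x.1).symm (zero_add x.2).symm
  rw [hx]
  exact P.add_mem (h₁ _) (h₂ _)

/-- The tensor product calculus over `A ⊗ B`, with one-forms `(Ω¹(A) ⊗ B) ⊕ (A ⊗ Ω¹(B))` and
differential `d ⊗ id + id ⊗ d`. -/
noncomputable def FODC.tensor : FODC k (A ⊗[k] B) where
  Form := TensorForm ΓA ΓB
  d := tensorD ΓA ΓB
  leibniz := tensorD_leibniz ΓA ΓB
  span_eq_top := tensorForm_span ΓA ΓB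

end Tensor
/-! ### Higher order differential calculi -/

/-- A differential calculus over a `k`-algebra `A`: a differential `ℕ`-graded algebra whose degree
zero part is `A` (embedded through `incl`) and which is generated in degree zero, that is, the
degree `n` part is the span of the products `a₀ * d a₁ * ⋯ * d aₙ`. -/
structure DiffCalculus (k : Type u₀) (A : Type u₁) [Field k] [Ring A] [Algebra k A] where
  Form : Type u₂
  [ring : Ring Form]
  [algebra : Algebra k Form]
  deg : ℕ → Submodule k Form
  [graded : GradedAlgebra deg]
  d : Form →ₗ[k] Form
  d_mem : ∀ (n : ℕ) (ω : Form), ω ∈ deg n → d ω ∈ deg (n + 1)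
  d_d : ∀ ω : Form, d (d ω) = 0
  leibniz : ∀ (n : ℕ) (ω η : Form), ω ∈ deg n → d (ω * η) = d ω * η + (-1 : k) ^ n • (ω * d η)
  incl : A →ₐ[k] Form
  incl_injective : Function.Injective incl
  deg_zero : deg 0 = LinearMap.range incl.toLinearMap
  deg_eq_span : ∀ n : ℕ, deg n = Submodule.span k {ω : Form | ∃ (a : A) (b : Fin n → A),
    ω = incl a * (List.ofFn fun i => d (incl (b i))).prod}

attribute [instance] DiffCalculus.ring DiffCalculus.algebra DiffCalculus.graded

namespace DiffCalculus

variable {k : Type u₀} [Field k] {A : Type u₁} [Ring A] [Algebra k A]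
  (Ω : DiffCalculus.{u₀, u₁, u₂} k A)

theorem incl_mem (a : A) : Ω.incl a ∈ Ω.deg 0 := by
  rw [Ω.deg_zero]; exact ⟨a, rfl⟩

/-- The space of one-forms of a differential calculus. -/
def OneForm : Type _ := ↥(Ω.deg 1)

noncomputable instance : AddCommGroup Ω.OneForm := inferInstanceAs (AddCommGroup ↥(Ω.deg 1))

noncomputable instance : Module k Ω.OneForm := inferInstanceAs (Module k ↥(Ω.deg 1))

theorem incl_mul_mem (a : A) {ω : Ω.Form} (hω : ω ∈ Ω.deg 1) : Ω.incl a * ω ∈ Ω.deg 1 := by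
  simpa using SetLike.mul_mem_graded (Ω.incl_mem a) hω

theorem mul_incl_mem (a : A) {ω : Ω.Form} (hω : ω ∈ Ω.deg 1) : ω * Ω.incl a ∈ Ω.deg 1 := by
  simpa using SetLike.mul_mem_graded hω (Ω.incl_mem a)

noncomputable instance : Module A Ω.OneForm where
  smul a ω := ⟨Ω.incl a * ω.1, Ω.incl_mul_mem a ω.2⟩
  one_smul ω := Subtype.ext (by change Ω.incl 1 * ω.1 = ω.1; simp)
  mul_smul a b ω := Subtype.ext (by
    change Ω.incl (a * b) * ω.1 = Ω.incl a * (Ω.incl b * ω.1); simp [mul_assoc])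
  smul_zero a := Subtype.ext (mul_zero (Ω.incl a))
  smul_add a ω η := Subtype.ext (mul_add (Ω.incl a) ω.1 η.1)
  add_smul a b ω := Subtype.ext (by
    change Ω.incl (a + b) * ω.1 = Ω.incl a * ω.1 + Ω.incl b * ω.1; simp [add_mul])
  zero_smul ω := Subtype.ext (by change Ω.incl 0 * ω.1 = 0; simp)

noncomputable instance : Module Aᵐᵒᵖ Ω.OneForm where
  smul a ω := ⟨ω.1 * Ω.incl a.unop, Ω.mul_incl_mem a.unop ω.2⟩
  one_smul ω := Subtype.ext (by change ω.1 * Ω.incl 1 = ω.1; simp)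
  mul_smul a b ω := Subtype.ext (by
    change ω.1 * Ω.incl (b.unop * a.unop) = ω.1 * Ω.incl b.unop * Ω.incl a.unop
    simp [mul_assoc])
  smul_zero a := Subtype.ext (zero_mul (Ω.incl a.unop))
  smul_add a ω η := Subtype.ext (add_mul ω.1 η.1 (Ω.incl a.unop))
  add_smul a b ω := Subtype.ext (by
    change ω.1 * Ω.incl (a.unop + b.unop) = ω.1 * Ω.incl a.unop + ω.1 * Ω.incl b.unop
    simp [mul_add])
  zero_smul ω := Subtype.ext (by change ω.1 * Ω.incl 0 = 0; simp)

instance : SMulCommClass A Aᵐᵒᵖ Ω.OneForm where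
  smul_comm a b ω := Subtype.ext (mul_assoc (Ω.incl a) ω.1 (Ω.incl b.unop)).symm

instance : IsScalarTower k A Ω.OneForm where
  smul_assoc c a ω := Subtype.ext (by
    change Ω.incl (c • a) * ω.1 = c • (Ω.incl a * ω.1); simp)

instance : IsScalarTower k Aᵐᵒᵖ Ω.OneForm where
  smul_assoc c a ω := Subtype.ext (by
    change ω.1 * Ω.incl (c • a.unop) = c • (ω.1 * Ω.incl a.unop); simp)

/-- The differential `A → Ω¹` of a differential calculus. -/
noncomputable def oneD : A →ₗ[k] Ω.OneForm :=
  (Ω.d ∘ₗ Ω.incl.toLinearMap).codRestrict (Ω.deg 1) fun a => Ω.d_mem 0 _ (Ω.incl_mem a)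

/-- The first order calculus `(Ω¹, d)` of a differential calculus, with the bimodule structure
given by multiplication in the algebra of forms. -/
noncomputable def truncation : FODC k A where
  Form := Ω.OneForm
  d := Ω.oneD
  leibniz a b := Subtype.ext (by
    change Ω.d (Ω.incl (a * b)) = Ω.d (Ω.incl a) * Ω.incl b + Ω.incl a * Ω.d (Ω.incl b)
    rw [map_mul, Ω.leibniz 0 _ _ (Ω.incl_mem a)]
    simp)
  span_eq_top := by
    have hinj : Function.Injective (Submodule.map (Ω.deg 1).subtype) :=
      Submodule.map_injective_of_injective (Submodule.injective_subtype _)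
    have key : Submodule.span k {ω : ↥(Ω.deg 1) | ∃ a b : A,
        (ω : Ω.Form) = Ω.incl a * Ω.d (Ω.incl b)} = ⊤ := by
      apply hinj
      rw [Submodule.map_span, Submodule.map_top, Submodule.range_subtype]
      conv_rhs => rw [Ω.deg_eq_span 1]
      congr 1
      ext ω
      constructor
      · rintro ⟨η, ⟨a, b, h⟩, rfl⟩
        exact ⟨a, fun _ => b, by simpa using h⟩
      · rintro ⟨a, b, rfl⟩
        exact ⟨⟨Ω.incl a * Ω.d (Ω.incl (b 0)),
          Ω.incl_mul_mem a (Ω.d_mem 0 _ (Ω.incl_mem _))⟩, ⟨a, b 0, rfl⟩, by simp⟩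
    have hset : {ω : Ω.OneForm | ∃ a b : A, ω = a • Ω.oneD b} =
        {ω : ↥(Ω.deg 1) | ∃ a b : A, (ω : Ω.Form) = Ω.incl a * Ω.d (Ω.incl b)} := by
      ext ω
      exact exists_congr fun a => exists_congr fun b => Subtype.ext_iff
    rw [hset]
    exact key

end DiffCalculus

/-! ### The maximal prolongation -/

section Prolongation

variable {k : Type u₀} [Field k] {A : Type u₁} [Ring A] [Algebra k A]
  (Γ : FODC.{u₀, u₁, u₂} k A)

/-- The relations of the maximal prolongation on the generators `(a, ω) ∈ A ⊕ Γ`. The relations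
`one`, `mul`, `left` and `right` present the tensor algebra `A ⊕ Γ ⊕ (Γ ⊗_A Γ) ⊕ ⋯` of the bimodule
`Γ`; the relations `wedge` are the generators `∑ d aᵢ ⊗_A d bᵢ`, where `∑ aᵢ d bᵢ = 0`, of the
ideal that is divided out. -/
inductive ProlongRel : TensorAlgebra k (A × Γ.Form) → TensorAlgebra k (A × Γ.Form) → Prop
  | one : ProlongRel (TensorAlgebra.ι k (1, 0)) 1
  | mul (a b : A) : ProlongRel (TensorAlgebra.ι k (a, 0) * TensorAlgebra.ι k (b, 0))
      (TensorAlgebra.ι k (a * b, 0))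
  | left (a : A) (ω : Γ.Form) : ProlongRel (TensorAlgebra.ι k (a, 0) * TensorAlgebra.ι k (0, ω))
      (TensorAlgebra.ι k (0, a • ω))
  | right (ω : Γ.Form) (a : A) : ProlongRel (TensorAlgebra.ι k (0, ω) * TensorAlgebra.ι k (a, 0))
      (TensorAlgebra.ι k (0, op a • ω))
  | wedge (n : ℕ) (a b : Fin n → A) (h : ∑ i, a i • Γ.d (b i) = 0) : ProlongRel
      (∑ i, TensorAlgebra.ι k (0, Γ.d (a i)) * TensorAlgebra.ι k (0, Γ.d (b i))) 0

/-- The algebra underlying the maximal prolongation: the quotient of the tensor algebra of the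
bimodule `Γ` by the ideal generated by the elements `∑ d aᵢ ⊗_A d bᵢ` with `∑ aᵢ d bᵢ = 0`. -/
def Prolong : Type _ := RingQuot (ProlongRel Γ)

namespace Prolong

noncomputable instance : Ring (Prolong Γ) := inferInstanceAs (Ring (RingQuot (ProlongRel Γ)))

noncomputable instance : Algebra k (Prolong Γ) :=
  inferInstanceAs (Algebra k (RingQuot (ProlongRel Γ)))

/-- The quotient map. -/
noncomputable def mk : TensorAlgebra k (A × Γ.Form) →ₐ[k] Prolong Γ :=
  RingQuot.mkAlgHom k (ProlongRel Γ)

theorem mk_rel {x y : TensorAlgebra k (A × Γ.Form)} (h : ProlongRel Γ x y) : mk Γ x = mk Γ y :=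
  RingQuot.mkAlgHom_rel k h

/-- The inclusion of one-forms. -/
noncomputable def ofForm : Γ.Form →ₗ[k] Prolong Γ :=
  (mk Γ).toLinearMap ∘ₗ TensorAlgebra.ι k ∘ₗ LinearMap.inr k A Γ.Form

/-- The inclusion of the base algebra. -/
noncomputable def ofBase : A →ₐ[k] Prolong Γ :=
  AlgHom.ofLinearMap ((mk Γ).toLinearMap ∘ₗ TensorAlgebra.ι k ∘ₗ LinearMap.inl k A Γ.Form)
    (by simpa using mk_rel Γ ProlongRel.one)
    (fun a b => by
      simpa using (mk_rel Γ (ProlongRel.mul a b)).symm)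

theorem mk_ι (x : A × Γ.Form) :
    mk Γ (TensorAlgebra.ι k x) = ofBase Γ x.1 + ofForm Γ x.2 := by
  have : x = (x.1, 0) + (0, x.2) := by simp
  conv_lhs => rw [this, map_add, map_add]
  rfl

theorem ofForm_left (a : A) (ω : Γ.Form) : ofForm Γ (a • ω) = ofBase Γ a * ofForm Γ ω := by
  have := mk_rel Γ (ProlongRel.left a ω)
  rw [map_mul] at this
  exact this.symm

theorem ofForm_right (a : A) (ω : Γ.Form) :
    ofForm Γ (op a • ω) = ofForm Γ ω * ofBase Γ a := by
  have := mk_rel Γ (ProlongRel.right ω a)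
  rw [map_mul] at this
  exact this.symm

theorem wedge_eq_zero (n : ℕ) (a b : Fin n → A) (h : ∑ i, a i • Γ.d (b i) = 0) :
    ∑ i, ofForm Γ (Γ.d (a i)) * ofForm Γ (Γ.d (b i)) = 0 := by
  have := mk_rel Γ (ProlongRel.wedge n a b h)
  simp only [map_sum, map_mul, map_zero] at this
  exact this

section Lift

variable {Γ} {R : Type*} [Ring R] [Algebra k R] (f : A →ₐ[k] R) (g : Γ.Form →ₗ[k] R)
  (hl : ∀ a ω, g (a • ω) = f a * g ω) (hr : ∀ a ω, g (op a • ω) = g ω * f a)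
  (hw : ∀ (n : ℕ) (a b : Fin n → A), ∑ i, a i • Γ.d (b i) = 0 →
    ∑ i, g (Γ.d (a i)) * g (Γ.d (b i)) = 0)

/-- The universal property of the maximal prolongation, as an algebra. -/
noncomputable def lift : Prolong Γ →ₐ[k] R :=
  RingQuot.liftAlgHom k ⟨TensorAlgebra.lift k (f.toLinearMap.coprod g), by
    intro x y h
    induction h with
    | one => simp
    | mul a b => simp
    | left a ω => simp [hl]
    | right ω a => simp [hr]
    | wedge n a b h => simpa using hw n a b h⟩

@[simp] theorem lift_mk (x : TensorAlgebra k (A × Γ.Form)) :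
    lift f g hl hr hw (mk Γ x) = TensorAlgebra.lift k (f.toLinearMap.coprod g) x :=
  RingQuot.liftAlgHom_mkAlgHom_apply _ _ _ _

@[simp] theorem lift_ofBase (a : A) : lift f g hl hr hw (ofBase Γ a) = f a := by
  change lift f g hl hr hw (mk Γ (TensorAlgebra.ι k (a, 0))) = f a
  simp

@[simp] theorem lift_ofForm (ω : Γ.Form) : lift f g hl hr hw (ofForm Γ ω) = g ω := by
  change lift f g hl hr hw (mk Γ (TensorAlgebra.ι k (0, ω))) = g ω
  simp

end Lift

variable {Γ} in
theorem induction {C : Prolong Γ → Prop} (hb : ∀ a, C (ofBase Γ a)) (hf : ∀ ω, C (ofForm Γ ω))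
    (hadd : ∀ x y, C x → C y → C (x + y)) (hmul : ∀ x y, C x → C y → C (x * y))
    (x : Prolong Γ) : C x := by
  obtain ⟨t, rfl⟩ : ∃ t, mk Γ t = x := RingQuot.mkAlgHom_surjective k _ x
  induction t using TensorAlgebra.induction with
  | algebraMap r =>
    rw [AlgHom.commutes, ← (ofBase Γ).commutes]
    exact hb _
  | ι x => rw [mk_ι]; exact hadd _ _ (hb _) (hf _)
  | mul x y hx hy => rw [map_mul]; exact hmul _ _ hx hy
  | add x y hx hy => rw [map_add]; exact hadd _ _ hx hy

variable {Γ} in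
theorem hom_ext {R : Type*} [Ring R] [Algebra k R] {f g : Prolong Γ →ₐ[k] R}
    (hb : ∀ a, f (ofBase Γ a) = g (ofBase Γ a)) (hf : ∀ ω, f (ofForm Γ ω) = g (ofForm Γ ω)) :
    f = g := by
  ext x
  induction x using Prolong.induction with
  | hb a => exact hb a
  | hf ω => exact hf ω
  | hadd x y hx hy => rw [map_add, map_add, hx, hy]
  | hmul x y hx hy => rw [map_mul, map_mul, hx, hy]

theorem ofBase_injective : Function.Injective (ofBase Γ) := by
  intro a b h
  have := congrArg (lift (AlgHom.id k A) (0 : Γ.Form →ₗ[k] A) (by simp) (by simp) (by simp)) h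
  simpa using this

theorem ofForm_injective : Function.Injective (ofForm Γ) := by
  intro ω η h
  have := congrArg (lift (TrivSqZeroExt.inlAlgHom k A Γ.Form) (TrivSqZeroExt.inrHom A Γ.Form |>.restrictScalars k)
    (by intro a ω; ext <;> simp) (by intro a ω; ext <;> simp) (by simp)) h
  simpa [TrivSqZeroExt.inr_injective.eq_iff] using this

/-! The grading. -/

/-- The subspace of exact one-forms `d a`. -/
noncomputable def exact : Submodule k (Prolong Γ) := LinearMap.range (ofForm Γ ∘ₗ Γ.d)

/-- The base algebra, as a subspace. -/
noncomputable def base : Submodule k (Prolong Γ) := LinearMap.range (ofBase Γ).toLinearMap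

/-- The degree `n` part, spanned by the products `a₀ * d a₁ * ⋯ * d aₙ`. -/
noncomputable def deg (n : ℕ) : Submodule k (Prolong Γ) := base Γ * exact Γ ^ n

theorem ofBase_mem_base (a : A) : ofBase Γ a ∈ base Γ := ⟨a, rfl⟩

theorem d_mem_exact (a : A) : ofForm Γ (Γ.d a) ∈ exact Γ := ⟨a, rfl⟩

theorem one_le_base : 1 ≤ base Γ := by
  rw [Submodule.one_le]
  exact ⟨1, map_one (ofBase Γ)⟩

theorem base_mul_base : base Γ * base Γ = base Γ := by
  refine le_antisymm ?_ ?_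
  · rw [Submodule.mul_le]
    rintro _ ⟨a, rfl⟩ _ ⟨b, rfl⟩
    exact ⟨a * b, map_mul (ofBase Γ) a b⟩
  · calc base Γ = base Γ * 1 := (mul_one _).symm
      _ ≤ base Γ * base Γ := mul_le_mul' le_rfl (one_le_base Γ)

theorem exact_mul_base : exact Γ * base Γ ≤ base Γ * exact Γ := by
  rw [Submodule.mul_le]
  rintro _ ⟨a, rfl⟩ _ ⟨b, rfl⟩
  have h : ofForm Γ (Γ.d a) * ofBase Γ b =
      ofBase Γ 1 * ofForm Γ (Γ.d (a * b)) - ofBase Γ a * ofForm Γ (Γ.d b) := by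
    rw [Γ.leibniz, map_add, ofForm_left, ofForm_right, map_one]
    simp
  change ofForm Γ (Γ.d a) * ofBase Γ b ∈ _
  rw [h]
  exact Submodule.sub_mem _
    (Submodule.mul_mem_mul (ofBase_mem_base Γ _) (d_mem_exact Γ _))
    (Submodule.mul_mem_mul (ofBase_mem_base Γ _) (d_mem_exact Γ _))

theorem exact_pow_mul_base (n : ℕ) : exact Γ ^ n * base Γ ≤ base Γ * exact Γ ^ n := by
  induction n with
  | zero => simp
  | succ n ih =>
    calc exact Γ ^ (n + 1) * base Γ = exact Γ ^ n * (exact Γ * base Γ) := by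
          rw [pow_succ, mul_assoc]
      _ ≤ exact Γ ^ n * (base Γ * exact Γ) := mul_le_mul' le_rfl (exact_mul_base Γ)
      _ = exact Γ ^ n * base Γ * exact Γ := (mul_assoc _ _ _).symm
      _ ≤ base Γ * exact Γ ^ n * exact Γ := mul_le_mul' ih le_rfl
      _ = base Γ * exact Γ ^ (n + 1) := by rw [pow_succ, mul_assoc]

theorem deg_mul_deg (m n : ℕ) : deg Γ m * deg Γ n ≤ deg Γ (m + n) := by
  calc deg Γ m * deg Γ n = base Γ * (exact Γ ^ m * base Γ) * exact Γ ^ n := by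
        simp only [deg, mul_assoc]
    _ ≤ base Γ * (base Γ * exact Γ ^ m) * exact Γ ^ n :=
        mul_le_mul' (mul_le_mul' le_rfl (exact_pow_mul_base Γ m)) le_rfl
    _ = base Γ * base Γ * (exact Γ ^ m * exact Γ ^ n) := by simp only [mul_assoc]
    _ = deg Γ (m + n) := by rw [base_mul_base, ← pow_add, deg]

theorem deg_zero : deg Γ 0 = base Γ := by simp [deg]

theorem range_ofForm : LinearMap.range (ofForm Γ) = deg Γ 1 := by
  rw [deg, pow_one, LinearMap.range_eq_map, ← Γ.span_eq_top, Submodule.map_span]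
  refine le_antisymm ?_ ?_
  · rw [Submodule.span_le]
    rintro _ ⟨_, ⟨a, b, rfl⟩, rfl⟩
    rw [ofForm_left]
    exact Submodule.mul_mem_mul (ofBase_mem_base Γ _) (d_mem_exact Γ _)
  · rw [Submodule.mul_le]
    rintro _ ⟨a, rfl⟩ _ ⟨b, rfl⟩
    exact Submodule.subset_span ⟨_, ⟨a, b, rfl⟩, ofForm_left Γ _ _⟩

theorem ofForm_mem (ω : Γ.Form) : ofForm Γ ω ∈ deg Γ 1 := range_ofForm Γ ▸ ⟨ω, rfl⟩

theorem ofBase_mem (a : A) : ofBase Γ a ∈ deg Γ 0 := deg_zero Γ ▸ ofBase_mem_base Γ a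

instance : SetLike.GradedMonoid (deg Γ) where
  one_mem := by rw [← map_one (ofBase Γ)]; exact ofBase_mem Γ 1
  mul_mem m n _ _ hx hy := deg_mul_deg Γ m n (Submodule.mul_mem_mul hx hy)

/-- The auxiliary algebra map to `(Prolong Γ)[X]` that multiplies a form of degree `n` by `X ^ n`. -/
noncomputable def degHom : Prolong Γ →ₐ[k] Polynomial (Prolong Γ) :=
  lift (Polynomial.CAlgHom.comp (ofBase Γ))
    ((LinearMap.mulRight k (Polynomial.X : Polynomial (Prolong Γ))) ∘ₗ
      Polynomial.CAlgHom.toLinearMap ∘ₗ ofForm Γ)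
    (fun a ω => by simp [ofForm_left, mul_assoc])
    (fun a ω => by simp [ofForm_right, mul_assoc, Polynomial.X_mul_C])
    (fun n a b h => by
      have e : ∀ x y : Prolong Γ, (Polynomial.C x * Polynomial.X) * (Polynomial.C y * Polynomial.X)
          = Polynomial.C (x * y) * Polynomial.X ^ 2 := by
        intro x y
        rw [mul_assoc, ← mul_assoc Polynomial.X, Polynomial.X_mul_C, map_mul, pow_two]
        simp only [mul_assoc]
      simp only [LinearMap.comp_apply, AlgHom.toLinearMap_apply, LinearMap.mulRight_apply,
        Polynomial.CAlgHom_apply, e]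
      rw [← Finset.sum_mul, ← map_sum, wedge_eq_zero Γ n a b h, map_zero, zero_mul])

theorem degHom_of_mem {n : ℕ} {x : Prolong Γ} (hx : x ∈ deg Γ n) :
    degHom Γ x = Polynomial.C x * Polynomial.X ^ n := by
  have hpow : ∀ (n : ℕ) (y : Prolong Γ), y ∈ exact Γ ^ n →
      degHom Γ y = Polynomial.C y * Polynomial.X ^ n := by
    intro n y hy
    induction hy using Submodule.pow_induction_on_left' with
    | algebraMap r =>
      rw [AlgHom.commutes, pow_zero, mul_one]; rfl
    | add x y i hx hy ihx ihy => rw [map_add, ihx, ihy, map_add, add_mul]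
    | mem_mul m hm i x hx ih =>
      obtain ⟨b, rfl⟩ := hm
      rw [map_mul, ih]
      simp only [degHom, LinearMap.comp_apply, lift_ofForm, LinearMap.mulRight_apply,
        AlgHom.toLinearMap_apply, Polynomial.CAlgHom_apply, map_mul, pow_succ']
      rw [mul_assoc, ← mul_assoc Polynomial.X, Polynomial.X_mul_C]
      simp only [mul_assoc]
  refine Submodule.mul_induction_on hx ?_ ?_
  · rintro _ ⟨a, rfl⟩ y hy
    rw [map_mul, hpow n y hy, map_mul, mul_assoc]
    congr 1
    simp [degHom]
  · intro x y hx hy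
    rw [map_add, hx, hy, map_add, add_mul]

theorem isInternal_deg : DirectSum.IsInternal (deg Γ) := by
  refine ⟨?_, ?_⟩
  · refine (injective_iff_map_eq_zero _).2 fun v hv => ?_
    have hc : ∀ (w : ⨁ n, deg Γ n) (n : ℕ),
        (degHom Γ (DirectSum.coeAddMonoidHom (deg Γ) w)).coeff n = w n := by
      intro w n
      induction w using DirectSum.induction_on with
      | zero => simp
      | add x y hx hy => simp only [map_add, Polynomial.coeff_add, hx, hy]; rfl
      | of i x =>
        rw [DirectSum.coeAddMonoidHom_of, degHom_of_mem Γ x.2, Polynomial.coeff_C_mul_X_pow]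
        by_cases h : n = i
        · subst h; simp
        · rw [if_neg h, DirectSum.of_eq_of_ne _ _ _ h]; rfl
    refine DFinsupp.ext fun n => Subtype.ext ?_
    rw [← hc v n, hv]
    simp
  · intro x
    suffices h : x ∈ (DirectSum.coeAlgHom (deg Γ)).range by exact h
    induction x using Prolong.induction with
    | hb a => exact ⟨DirectSum.of (fun n => deg Γ n) 0 ⟨_, ofBase_mem Γ a⟩, by simp⟩
    | hf ω => exact ⟨DirectSum.of (fun n => deg Γ n) 1 ⟨_, ofForm_mem Γ ω⟩, by simp⟩
    | hadd x y hx hy => exact add_mem hx hy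
    | hmul x y hx hy => exact mul_mem hx hy

noncomputable instance : GradedAlgebra (deg Γ) where
  toDecomposition := (isInternal_deg Γ).chooseDecomposition

theorem deg_eq_span (n : ℕ) : deg Γ n = Submodule.span k {ω | ∃ (a : A) (b : Fin n → A),
    ω = ofBase Γ a * (List.ofFn fun i => ofForm Γ (Γ.d (b i))).prod} := by
  rw [deg, Submodule.pow_eq_span_pow_set, ← Submodule.span_eq (base Γ), Submodule.span_mul_span]
  congr 1
  ext ω
  constructor
  · rintro ⟨_, ⟨a, rfl⟩, y, hy, rfl⟩
    obtain ⟨f, rfl⟩ := Set.mem_pow.1 hy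
    choose b hb using fun i => (f i).2
    refine ⟨a, b, ?_⟩
    simp only [← hb]
    rfl
  · rintro ⟨a, b, rfl⟩
    exact ⟨_, ofBase_mem_base Γ a, _,
      Set.mem_pow.2 ⟨fun i => ⟨_, d_mem_exact Γ (b i)⟩, rfl⟩, rfl⟩

/-! The differential. -/

/-- The linear map `A ⊗ A → Γ`, `a ⊗ b ↦ a d b`. -/
noncomputable def leftD : A ⊗[k] A →ₗ[k] Γ.Form :=
  TensorProduct.lift ((Algebra.lsmul k k Γ.Form).toLinearMap.compl₂ Γ.d)

/-- The linear map `A ⊗ A → Γ^∧`, `a ⊗ b ↦ d a ∧ d b`. -/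
noncomputable def wedgeD : A ⊗[k] A →ₗ[k] Prolong Γ :=
  TensorProduct.lift
    ((LinearMap.mul k (Prolong Γ)).compl₁₂ (ofForm Γ ∘ₗ Γ.d) (ofForm Γ ∘ₗ Γ.d))

theorem leftD_surjective : Function.Surjective (leftD Γ) := by
  rw [← LinearMap.range_eq_top, eq_top_iff, ← Γ.span_eq_top, Submodule.span_le]
  rintro _ ⟨a, b, rfl⟩
  exact ⟨a ⊗ₜ b, by simp [leftD]⟩

theorem ker_leftD_le : LinearMap.ker (leftD Γ) ≤ LinearMap.ker (wedgeD Γ) := by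
  intro x hx
  obtain ⟨s, rfl⟩ := TensorProduct.exists_finset x
  rw [LinearMap.mem_ker] at hx ⊢
  have e := s.equivFin.symm
  have h := wedge_eq_zero Γ _ (fun i => (s.equivFin.symm i).1.1)
    (fun i => (s.equivFin.symm i).1.2) (by
      rw [Equiv.sum_comp s.equivFin.symm (fun i => i.1.1 • Γ.d i.1.2),
        Finset.sum_coe_sort s (fun i => i.1 • Γ.d i.2)]
      simpa [leftD] using hx)
  rw [Equiv.sum_comp s.equivFin.symm (fun i => ofForm Γ (Γ.d i.1.1) * ofForm Γ (Γ.d i.1.2)),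
    Finset.sum_coe_sort s (fun i => ofForm Γ (Γ.d i.1) * ofForm Γ (Γ.d i.2))] at h
  simpa [wedgeD] using h

/-- The differential on one-forms, `a d b ↦ d a ∧ d b`. -/
noncomputable def dForm : Γ.Form →ₗ[k] Prolong Γ :=
  (LinearMap.ker (leftD Γ)).liftQ (wedgeD Γ) (ker_leftD_le Γ) ∘ₗ
    ((leftD Γ).quotKerEquivOfSurjective (leftD_surjective Γ)).symm.toLinearMap

theorem dForm_leftD (x : A ⊗[k] A) : dForm Γ (leftD Γ x) = wedgeD Γ x := by
  have h : ((leftD Γ).quotKerEquivOfSurjective (leftD_surjective Γ)).symm (leftD Γ x) =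
      Submodule.Quotient.mk x := by
    rw [LinearEquiv.symm_apply_eq]; rfl
  simp only [dForm, LinearMap.comp_apply, LinearEquiv.coe_coe, h]
  rfl

theorem dForm_smul_d (a b : A) :
    dForm Γ (a • Γ.d b) = ofForm Γ (Γ.d a) * ofForm Γ (Γ.d b) := by
  have := dForm_leftD Γ (a ⊗ₜ b)
  simpa [leftD, wedgeD] using this

variable {Γ} in
theorem form_induction {C : Γ.Form → Prop} (h : ∀ a b : A, C (a • Γ.d b))
    (hadd : ∀ ω η, C ω → C η → C (ω + η)) (ω : Γ.Form) : C ω := by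
  obtain ⟨x, rfl⟩ := leftD_surjective Γ ω
  induction x with
  | zero => simpa using h 0 0
  | tmul a b => simpa [leftD] using h a b
  | add x y hx hy => rw [map_add]; exact hadd _ _ hx hy

theorem dForm_d (a : A) : dForm Γ (Γ.d a) = 0 := by
  have := dForm_smul_d Γ 1 a
  rwa [one_smul, Γ.d_one, map_zero, zero_mul] at this

theorem dForm_left (a : A) (ω : Γ.Form) :
    dForm Γ (a • ω) = ofForm Γ (Γ.d a) * ofForm Γ ω + ofBase Γ a * dForm Γ ω := by
  induction ω using form_induction with
  | h b c =>
    rw [smul_smul, dForm_smul_d, dForm_smul_d, Γ.leibniz, map_add, ofForm_left, ofForm_left,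
      ofForm_right, add_mul]
    simp only [mul_assoc]
  | hadd x y hx hy => rw [smul_add, map_add, map_add, map_add, hx, hy, mul_add, mul_add]; abel

theorem dForm_right (a : A) (ω : Γ.Form) :
    dForm Γ (op a • ω) = dForm Γ ω * ofBase Γ a - ofForm Γ ω * ofForm Γ (Γ.d a) := by
  induction ω using form_induction with
  | h b c =>
    have e : op a • b • Γ.d c = b • Γ.d (c * a) - (b * c) • Γ.d a := by
      rw [Γ.leibniz, smul_add, smul_smul, add_sub_cancel_right, smul_comm b (op a) (Γ.d c)]
    rw [e, map_sub, dForm_smul_d, dForm_smul_d, dForm_smul_d, Γ.leibniz, Γ.leibniz, ofForm_left,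
      map_add, map_add, ofForm_left, ofForm_right, ofForm_left, ofForm_right]
    noncomm_ring
  | hadd x y hx hy => rw [smul_add, map_add, map_add, map_add, hx, hy, add_mul, add_mul]; abel

/-- An upper triangular matrix. -/
def upper {R : Type*} [Ring R] (x y z : R) : Matrix (Fin 2) (Fin 2) R := !![x, y; 0, z]

theorem upper_mul {R : Type*} [Ring R] (x y z x' y' z' : R) :
    upper x y z * upper x' y' z' = upper (x * x') (x * y' + y * z') (z * z') := by
  simp [upper]

theorem upper_add {R : Type*} [Ring R] (x y z x' y' z' : R) :
    upper x y z + upper x' y' z' = upper (x + x') (y + y') (z + z') := by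
  simp [upper]

theorem upper_smul {R : Type*} [Ring R] [Algebra k R] (c : k) (x y z : R) :
    c • upper x y z = upper (c • x) (c • y) (c • z) := by
  simp [upper]

theorem upper_one {R : Type*} [Ring R] : (upper 1 0 1 : Matrix (Fin 2) (Fin 2) R) = 1 :=
  Matrix.one_fin_two.symm

theorem upper_zero {R : Type*} [Ring R] : (upper 0 0 0 : Matrix (Fin 2) (Fin 2) R) = 0 :=
  Matrix.ext fun i j => by fin_cases i <;> fin_cases j <;> rfl

theorem sum_upper {R : Type*} [Ring R] {n : ℕ} (x y z : Fin n → R) :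
    ∑ i, upper (x i) (y i) (z i) = upper (∑ i, x i) (∑ i, y i) (∑ i, z i) := by
  induction n with
  | zero => simp [upper_zero]
  | succ n ih => simp only [Fin.sum_univ_succ, ih, upper_add]

/-- The algebra map `a ↦ [[a, d a], [0, a]]`. -/
noncomputable def dBaseHom : A →ₐ[k] Matrix (Fin 2) (Fin 2) (Prolong Γ) :=
  AlgHom.ofLinearMap
    { toFun := fun a => upper (ofBase Γ a) (ofForm Γ (Γ.d a)) (ofBase Γ a)
      map_add' := fun a b => by simp only [map_add, upper_add]
      map_smul' := fun c a => by simp only [map_smul, upper_smul, RingHom.id_apply] }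
    (by
      change upper (ofBase Γ 1) (ofForm Γ (Γ.d 1)) (ofBase Γ 1) = 1
      rw [Γ.d_one, map_zero, map_one, upper_one])
    (fun a b => by
      change upper _ _ _ = upper _ _ _ * upper _ _ _
      rw [upper_mul, map_mul, Γ.leibniz, map_add, ofForm_left, ofForm_right, add_comm])

/-- The linear map `ω ↦ [[-ω, d ω], [0, ω]]`. -/
noncomputable def dFormMap : Γ.Form →ₗ[k] Matrix (Fin 2) (Fin 2) (Prolong Γ) where
  toFun ω := upper (-ofForm Γ ω) (dForm Γ ω) (ofForm Γ ω)
  map_add' ω η := by simp only [map_add, upper_add, neg_add]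
  map_smul' c ω := by simp only [map_smul, upper_smul, RingHom.id_apply, smul_neg]

/-- The auxiliary algebra map `x ↦ [[σ x, d x], [0, x]]` with `σ` the sign of the degree; being
multiplicative means that `d` is a graded derivation. -/
noncomputable def dHom : Prolong Γ →ₐ[k] Matrix (Fin 2) (Fin 2) (Prolong Γ) :=
  lift (dBaseHom Γ) (dFormMap Γ)
    (fun a ω => by
      change upper _ _ _ = upper _ _ _ * upper _ _ _
      rw [upper_mul, ofForm_left, dForm_left, mul_neg, add_comm])
    (fun a ω => by
      change upper _ _ _ = upper _ _ _ * upper _ _ _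
      rw [upper_mul, ofForm_right, dForm_right, neg_mul, neg_mul, sub_eq_add_neg, add_comm])
    (fun n a b h => by
      have e : ∀ x y : A, dFormMap Γ (Γ.d x) * dFormMap Γ (Γ.d y) =
          upper (ofForm Γ (Γ.d x) * ofForm Γ (Γ.d y)) 0
            (ofForm Γ (Γ.d x) * ofForm Γ (Γ.d y)) := by
        intro x y
        change upper _ _ _ * upper _ _ _ = _
        rw [upper_mul, dForm_d, dForm_d, neg_mul_neg, mul_zero, zero_mul, add_zero]
      simp only [e]
      rw [sum_upper, wedge_eq_zero Γ n a b h, Finset.sum_const_zero, upper_zero])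

theorem dHom_ofBase (a : A) : dHom Γ (ofBase Γ a) =
    upper (ofBase Γ a) (ofForm Γ (Γ.d a)) (ofBase Γ a) := lift_ofBase _ _ _ _ _ a

theorem dHom_ofForm (ω : Γ.Form) : dHom Γ (ofForm Γ ω) =
    upper (-ofForm Γ ω) (dForm Γ ω) (ofForm Γ ω) := lift_ofForm _ _ _ _ _ ω

/-- The differential of the maximal prolongation. -/
noncomputable def d : Prolong Γ →ₗ[k] Prolong Γ where
  toFun x := dHom Γ x 0 1
  map_add' x y := by simp
  map_smul' c x := by simp

/-- The sign automorphism `ω ↦ (-1)ⁿ ω` on forms of degree `n`. -/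
noncomputable def sign : Prolong Γ →ₐ[k] Prolong Γ :=
  lift (ofBase Γ) (-ofForm Γ) (fun a ω => by simp [ofForm_left])
    (fun a ω => by simp [ofForm_right])
    (fun n a b h => by simpa using wedge_eq_zero Γ n a b h)

@[simp] theorem sign_ofBase (a : A) : sign Γ (ofBase Γ a) = ofBase Γ a := by simp [sign]

@[simp] theorem sign_ofForm (ω : Γ.Form) : sign Γ (ofForm Γ ω) = -ofForm Γ ω := by simp [sign]

theorem dHom_eq (x : Prolong Γ) : dHom Γ x = upper (sign Γ x) (d Γ x) x := by
  suffices h : ∃ y, dHom Γ x = upper (sign Γ x) y x by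
    obtain ⟨y, hy⟩ := h
    have : d Γ x = y := by
      change dHom Γ x 0 1 = y
      rw [hy]
      rfl
    rw [this, hy]
  induction x using Prolong.induction with
  | hb a => exact ⟨_, by rw [dHom_ofBase, sign_ofBase]⟩
  | hf ω => exact ⟨_, by rw [dHom_ofForm, sign_ofForm]⟩
  | hadd x y hx hy =>
    obtain ⟨x', hx⟩ := hx
    obtain ⟨y', hy⟩ := hy
    exact ⟨_, by rw [map_add, hx, hy, upper_add, map_add]⟩
  | hmul x y hx hy =>
    obtain ⟨x', hx⟩ := hx
    obtain ⟨y', hy⟩ := hy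
    exact ⟨_, by rw [map_mul, hx, hy, upper_mul, map_mul]⟩

theorem d_mul (x y : Prolong Γ) : d Γ (x * y) = d Γ x * y + sign Γ x * d Γ y := by
  change dHom Γ (x * y) 0 1 = _
  rw [map_mul, dHom_eq, dHom_eq, upper_mul, add_comm]
  rfl

@[simp] theorem d_ofBase (a : A) : d Γ (ofBase Γ a) = ofForm Γ (Γ.d a) := by
  change dHom Γ (ofBase Γ a) 0 1 = _
  rw [dHom_ofBase]
  rfl

@[simp] theorem d_ofForm (ω : Γ.Form) : d Γ (ofForm Γ ω) = dForm Γ ω := by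
  change dHom Γ (ofForm Γ ω) 0 1 = _
  rw [dHom_ofForm]
  rfl

variable {Γ} in
theorem pow_induction {C : ℕ → Prolong Γ → Prop} (hb : ∀ a, C 0 (ofBase Γ a))
    (hadd : ∀ n x y, C n x → C n y → C n (x + y))
    (hmul : ∀ n x b, x ∈ deg Γ n → C n x → C (n + 1) (x * ofForm Γ (Γ.d b)))
    (n : ℕ) (x : Prolong Γ) (hx : x ∈ deg Γ n) : C n x := by
  induction n generalizing x with
  | zero =>
    rw [deg_zero] at hx
    obtain ⟨a, rfl⟩ := hx
    exact hb a
  | succ n ih =>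
    rw [deg, pow_succ, ← mul_assoc] at hx
    refine Submodule.mul_induction_on hx ?_ fun x y => hadd _ x y
    rintro x hx _ ⟨b, rfl⟩
    exact hmul n x b hx (ih x hx)

theorem sign_of_mem (n : ℕ) (x : Prolong Γ) (hx : x ∈ deg Γ n) :
    sign Γ x = (-1 : k) ^ n • x := by
  refine pow_induction (C := fun n x => sign Γ x = (-1 : k) ^ n • x) (fun a => ?_)
    (fun n x y hx hy => ?_) (fun n x b _ hx => ?_) n x hx
  · rw [sign_ofBase, pow_zero, one_smul]
  · rw [map_add, hx, hy, smul_add]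
  · rw [map_mul, hx, sign_ofForm, pow_succ, smul_mul_assoc, mul_neg, mul_neg_one, neg_smul,
      smul_neg]

theorem d_mem (n : ℕ) (x : Prolong Γ) (hx : x ∈ deg Γ n) : d Γ x ∈ deg Γ (n + 1) := by
  refine pow_induction (C := fun n x => d Γ x ∈ deg Γ (n + 1)) (fun a => ?_)
    (fun n x y hx hy => ?_) (fun n x b _ hx => ?_) n x hx
  · rw [d_ofBase]
    exact ofForm_mem Γ _
  · rw [map_add]
    exact Submodule.add_mem _ hx hy
  · rw [d_mul, d_ofForm, dForm_d, mul_zero, add_zero]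
    exact deg_mul_deg Γ _ _ (Submodule.mul_mem_mul hx (ofForm_mem Γ _))

theorem d_d (x : Prolong Γ) : d Γ (d Γ x) = 0 := by
  have hs : ∀ x, d Γ (sign Γ x) = -sign Γ (d Γ x) := by
    intro x
    induction x using Prolong.induction with
    | hb a => simp
    | hf ω =>
      rw [sign_ofForm, map_neg, d_ofForm]
      induction ω using form_induction with
      | h a b => rw [dForm_smul_d, map_mul]; simp
      | hadd x y hx hy => rw [map_add, map_add, neg_add, hx, hy, neg_add]
    | hadd x y hx hy => rw [map_add, map_add, map_add, map_add, hx, hy, neg_add]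
    | hmul x y hx hy =>
      rw [map_mul, d_mul, d_mul, map_add, map_mul, map_mul, hx, hy]
      noncomm_ring
  induction x using Prolong.induction with
  | hb a => rw [d_ofBase, d_ofForm, dForm_d]
  | hf ω =>
    rw [d_ofForm]
    induction ω using form_induction with
    | h a b => rw [dForm_smul_d, d_mul, d_ofForm, d_ofForm, dForm_d, dForm_d]; simp
    | hadd x y hx hy => rw [map_add, map_add, hx, hy, add_zero]
  | hadd x y hx hy => rw [map_add, map_add, hx, hy, add_zero]
  | hmul x y hx hy =>
    rw [d_mul, map_add, d_mul, d_mul, hx, hy, hs]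
    noncomm_ring

end Prolong

/-- The maximal prolongation of a first order differential calculus. -/
noncomputable def maximalProlongation : DiffCalculus k A where
  Form := Prolong Γ
  deg := Prolong.deg Γ
  d := Prolong.d Γ
  d_mem := Prolong.d_mem Γ
  d_d := Prolong.d_d Γ
  leibniz n ω η hω := by rw [Prolong.d_mul, Prolong.sign_of_mem Γ n ω hω, smul_mul_assoc]
  incl := Prolong.ofBase Γ
  incl_injective := Prolong.ofBase_injective Γ
  deg_zero := Prolong.deg_zero Γ
  deg_eq_span n := by simpa using Prolong.deg_eq_span Γ n

end Prolongation

/-! ### Hopf–Galois extensions -/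

section HopfGalois

/-- The tensor product `X ⊗_B M` of a right `B`-module `X` and a left `B`-module `M` over a ring `B`
that need not be commutative. -/
def BalancedTensor (B X M : Type*) [Ring B] [AddCommGroup X] [Module Bᵐᵒᵖ X] [AddCommGroup M]
    [Module B M] : Type _ :=
  (X ⊗[ℤ] M) ⧸ AddSubgroup.closure
    {t : X ⊗[ℤ] M | ∃ (x : X) (b : B) (m : M), t = (op b • x) ⊗ₜ[ℤ] m - x ⊗ₜ[ℤ] (b • m)}

namespace BalancedTensor

variable {B X Y M : Type*} [Ring B] [AddCommGroup X] [Module Bᵐᵒᵖ X] [AddCommGroup Y]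
  [Module Bᵐᵒᵖ Y] [AddCommGroup M] [Module B M]

instance : AddCommGroup (BalancedTensor B X M) :=
  inferInstanceAs (AddCommGroup ((X ⊗[ℤ] M) ⧸ AddSubgroup.closure
    {t : X ⊗[ℤ] M | ∃ (x : X) (b : B) (m : M), t = (op b • x) ⊗ₜ[ℤ] m - x ⊗ₜ[ℤ] (b • m)}))

/-- The class `x ⊗_B m`. -/
def tmul (B : Type*) [Ring B] [Module Bᵐᵒᵖ X] [Module B M] (x : X) (m : M) :
    BalancedTensor B X M :=
  QuotientAddGroup.mk (x ⊗ₜ[ℤ] m)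

/-- The map `X ⊗_B M → Z` induced by a balanced biadditive map. -/
def lift {Z : Type*} [AddCommGroup Z] (φ : X →+ M →+ Z)
    (h : ∀ x (b : B) m, φ (op b • x) m = φ x (b • m)) : BalancedTensor B X M →+ Z :=
  QuotientAddGroup.lift _
    (TensorProduct.liftAddHom φ fun r x m => by rw [map_zsmul, map_zsmul, AddMonoidHom.zsmul_apply])
    (by
      rw [AddSubgroup.closure_le]
      rintro _ ⟨x, b, m, rfl⟩
      simp [h])

@[simp] theorem lift_tmul {Z : Type*} [AddCommGroup Z] (φ : X →+ M →+ Z)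
    (h : ∀ x (b : B) m, φ (op b • x) m = φ x (b • m)) (x : X) (m : M) :
    lift φ h (tmul B x m) = φ x m := rfl

/-- The map `f ⊗_B id : X ⊗_B M → Y ⊗_B M`. -/
def rTensor (M : Type*) [AddCommGroup M] [Module B M] (f : X →ₗ[Bᵐᵒᵖ] Y) :
    BalancedTensor B X M →+ BalancedTensor B Y M :=
  QuotientAddGroup.map _ _ (TensorProduct.map f.toAddMonoidHom.toIntLinearMap
      (LinearMap.id : M →ₗ[ℤ] M)).toAddMonoidHom (by
    rw [AddSubgroup.closure_le]
    rintro _ ⟨x, b, m, rfl⟩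
    refine AddSubgroup.subset_closure ⟨f x, b, m, ?_⟩
    simp)

@[simp] theorem rTensor_tmul (f : X →ₗ[Bᵐᵒᵖ] Y) (x : X) (m : M) :
    rTensor M f (tmul B x m) = tmul B (f x) m := rfl

end BalancedTensor

/-- A left `B`-module `M` is faithfully flat if a sequence `0 → X → Y → Z → 0` of right `B`-modules
is short exact if and only if `0 → X ⊗_B M → Y ⊗_B M → Z ⊗_B M → 0` is. -/
def IsFaithfullyFlat (B M : Type u₁) [Ring B] [AddCommGroup M] [Module B M] : Prop :=
  ∀ (X Y Z : Type u₁) [AddCommGroup X] [AddCommGroup Y] [AddCommGroup Z]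
    [Module Bᵐᵒᵖ X] [Module Bᵐᵒᵖ Y] [Module Bᵐᵒᵖ Z] (f : X →ₗ[Bᵐᵒᵖ] Y) (g : Y →ₗ[Bᵐᵒᵖ] Z),
    (Function.Injective f ∧ Function.Exact f g ∧ Function.Surjective g) ↔
      (Function.Injective (BalancedTensor.rTensor M f) ∧
        Function.Exact (BalancedTensor.rTensor M f) (BalancedTensor.rTensor M g) ∧
        Function.Surjective (BalancedTensor.rTensor M g))

variable {k : Type u₀} [Field k] {H : Type u₁} [Ring H] [HopfAlgebra k H]

/-- A linear map `δ : V → V ⊗ H` is a right `H`-coaction. -/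
structure IsRightCoaction {V : Type*} [AddCommGroup V] [Module k V] (δ : V →ₗ[k] V ⊗[k] H) :
    Prop where
  coassoc : TensorProduct.assoc k V H H ∘ₗ TensorProduct.map δ LinearMap.id ∘ₗ δ =
    TensorProduct.map LinearMap.id (Coalgebra.comul (R := k)) ∘ₗ δ
  counit : TensorProduct.rid k V ∘ₗ
    TensorProduct.map LinearMap.id (Coalgebra.counit (R := k) (A := H)) ∘ₗ δ = LinearMap.id

/-- A linear map `δ : V → H ⊗ V` is a left `H`-coaction. -/
structure IsLeftCoaction {V : Type*} [AddCommGroup V] [Module k V] (δ : V →ₗ[k] H ⊗[k] V) :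
    Prop where
  coassoc : TensorProduct.map LinearMap.id δ ∘ₗ δ =
    TensorProduct.assoc k H H V ∘ₗ TensorProduct.map (Coalgebra.comul (R := k)) LinearMap.id ∘ₗ δ
  counit : TensorProduct.lid k V ∘ₗ
    TensorProduct.map (Coalgebra.counit (R := k) (A := H)) LinearMap.id ∘ₗ δ = LinearMap.id

variable {A : Type u₂} [Ring A] [Algebra k A]

/-- The subalgebra `A^{co H} = {a | ρ a = a ⊗ 1}` of coinvariants of a coaction. -/
def coinvariants (ρ : A →ₐ[k] A ⊗[k] H) : Subalgebra k A :=
  AlgHom.equalizer ρ Algebra.TensorProduct.includeLeft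

/-- The right multiplication action of a subalgebra. -/
instance subalgebraRightModule (B : Subalgebra k A) : Module (↥B)ᵐᵒᵖ A :=
  Module.compHom A (RingHom.op B.val.toRingHom)

theorem subalgebra_op_smul (B : Subalgebra k A) (b : B) (a : A) : op b • a = a * (b : A) := rfl

/-- The canonical map `A ⊗_B A → A ⊗ H`, `a ⊗ a' ↦ (a ⊗ 1) ρ(a')`, where `B = A^{co H}`. -/
noncomputable def canonicalMap (ρ : A →ₐ[k] A ⊗[k] H) :
    BalancedTensor (coinvariants ρ) A A →+ A ⊗[k] H :=
  BalancedTensor.lift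
    ((AddMonoidHom.mul.comp
      ((Algebra.TensorProduct.includeLeft : A →ₐ[k] A ⊗[k] H) : A →+ A ⊗[k] H)).compl₂
        (ρ : A →+ A ⊗[k] H))
    (fun a b a' => by
      have hb : ρ (b : A) = (b : A) ⊗ₜ[k] (1 : H) := b.2
      have e : b • a' = (b : A) * a' := rfl
      simp [subalgebra_op_smul, e, hb, ← mul_assoc])

@[simp] theorem canonicalMap_tmul (ρ : A →ₐ[k] A ⊗[k] H) (a a' : A) :
    canonicalMap ρ (BalancedTensor.tmul (coinvariants ρ) a a') = (a ⊗ₜ[k] (1 : H)) * ρ a' := rfl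

/-- `A^{co H} ⊆ A` is a faithfully flat Hopf–Galois extension, for the right `H`-comodule algebra
`A` with coaction `ρ`. -/
structure IsFaithfullyFlatHopfGalois (ρ : A →ₐ[k] A ⊗[k] H) : Prop where
  coaction : IsRightCoaction ρ.toLinearMap
  galois : Function.Bijective (canonicalMap ρ)
  faithfullyFlat : IsFaithfullyFlat (coinvariants ρ) A

end HopfGalois

/-! ### Quantum principal bundles -/

section Bundles

variable {k : Type u₀} [Field k] {H : Type u₁} [Ring H] [HopfAlgebra k H]
  {A : Type u₂} [Ring A] [Algebra k A]

/-- A first order calculus over a right `H`-comodule algebra `(A, ρ)` is right `H`-covariant: there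
is a right coaction on `Γ` that is compatible with the bimodule structure and for which `d` is
colinear. -/
def FODC.IsRightCovariant (Γ : FODC.{u₀, u₂, u₃} k A) (ρ : A →ₐ[k] A ⊗[k] H) : Prop :=
  ∃ δ : Γ.Form →ₗ[k] Γ.Form ⊗[k] H, IsRightCoaction δ ∧
    (∀ (a b : A) (ω : Γ.Form), δ (a • op b • ω) =
      tensorLeftAct k A H Γ.Form H (ρ a) (tensorRightAct k A H Γ.Form H (op (ρ b)) (δ ω))) ∧
    ∀ a : A, δ (Γ.d a) = TensorProduct.map Γ.d LinearMap.id (ρ a)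

/-- The data of a left covariant structure on a first order calculus over the Hopf algebra `H`: a
left coaction on `Γ` that is compatible with the bimodule structure and for which `d` is
colinear. Such a coaction is unique if it exists. -/
structure LeftCovariance (Γ : FODC.{u₀, u₁, u₃} k H) where
  coact : Γ.Form →ₗ[k] H ⊗[k] Γ.Form
  isLeftCoaction : IsLeftCoaction coact
  map_bimodule : ∀ (a b : H) (ω : Γ.Form), coact (a • op b • ω) =
    tensorLeftAct k H H H Γ.Form (Coalgebra.comul (R := k) a)
      (tensorRightAct k H H H Γ.Form (op (Coalgebra.comul (R := k) b)) (coact ω))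
  map_d : ∀ a : H, coact (Γ.d a) =
    TensorProduct.map LinearMap.id Γ.d (Coalgebra.comul (R := k) a)

/-- The space `Λ¹ = {ω | _ΓΔ(ω) = 1 ⊗ ω}` of left coinvariant one-forms on `H`. -/
def LeftCovariance.coinvariantForms {Γ : FODC.{u₀, u₁, u₃} k H} (L : LeftCovariance Γ) :
    Submodule k Γ.Form :=
  LinearMap.eqLocus L.coact (TensorProduct.mk k H Γ.Form 1)

/-- A first order calculus over the Hopf algebra `H` is bicovariant: it is left covariant and right
covariant for the coproduct. -/
def FODC.IsBicovariant (Γ : FODC.{u₀, u₁, u₃} k H) : Prop :=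
  Nonempty (LeftCovariance Γ) ∧ Γ.IsRightCovariant (Bialgebra.comulAlgHom k H)

/-- The quantum Maurer–Cartan form `ϖ(h) = S(h₁) d h₂`, as a map `H → Γ`. -/
noncomputable def FODC.maurerCartan (Γ : FODC.{u₀, u₁, u₃} k H) : H →ₗ[k] Γ.Form :=
  TensorProduct.lift ((Algebra.lsmul k k Γ.Form).toLinearMap.compl₁₂ (HopfAlgebra.antipode k) Γ.d)
    ∘ₗ Coalgebra.comul (R := k)

/-- The Brzeziński–Majid horizontal one-forms `A d(B) A`, where `B = A^{co H}`. -/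
def horizontalBM (ρ : A →ₐ[k] A ⊗[k] H) (Γ : FODC.{u₀, u₂, u₃} k A) : Submodule k Γ.Form :=
  Submodule.span k {ω | ∃ (a a' : A) (b : coinvariants ρ), ω = a • op a' • Γ.d b}

/-- `(ΓA, ΓH)` is a Brzeziński–Majid quantum principal bundle on the right `H`-comodule algebra
`(A, ρ)`: `ΓA` is right covariant, `ΓH` is bicovariant, the map `ver : ΓA → A ⊗ Λ¹`,
`a d a' ↦ a a'₀ ⊗ ϖ(a'₁)` is well defined (the formula is stated after the inclusion of `A ⊗ Λ¹`
into `A ⊗ ΓH`), and `0 → A d(B) A → ΓA → A ⊗ Λ¹ → 0` is exact. -/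
def IsBrzezinskiMajidBundle (ρ : A →ₐ[k] A ⊗[k] H) (ΓA : FODC.{u₀, u₂, u₃} k A)
    (ΓH : FODC.{u₀, u₁, u₄} k H) : Prop :=
  ΓA.IsRightCovariant ρ ∧ ΓH.IsRightCovariant (Bialgebra.comulAlgHom k H) ∧
    ∃ (L : LeftCovariance ΓH) (ver : ΓA.Form →ₗ[k] A ⊗[k] L.coinvariantForms),
      (∀ a a' : A, TensorProduct.map LinearMap.id L.coinvariantForms.subtype
          (ver (a • ΓA.d a')) =
        TensorProduct.map (LinearMap.mulLeft k a) ΓH.maurerCartan (ρ a')) ∧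
      LinearMap.ker ver = horizontalBM ρ ΓA ∧ Function.Surjective ver

/-- A lift of the coaction `ρ : A → A ⊗ H` to a morphism of first order differential calculi
`Δ¹ : Ω¹(A) → Ω¹(A ⊗ H) = (Ω¹(A) ⊗ H) ⊕ (A ⊗ Ω¹(H))`. -/
abbrev CoactionLift (ρ : A →ₐ[k] A ⊗[k] H) (ΓA : FODC.{u₀, u₂, u₃} k A)
    (ΓH : FODC.{u₀, u₁, u₄} k H) :=
  FODC.Hom ΓA (FODC.tensor ΓA ΓH) ρ

/-- A differential calculus on the quantum principal bundle `(A, ρ)` is first order complete, with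
respect to a differential calculus on `H`: the coaction is `1`-differentiable. -/
def IsFirstOrderComplete (ρ : A →ₐ[k] A ⊗[k] H) (ΩA : DiffCalculus.{u₀, u₂, u₃} k A)
    (ΩH : DiffCalculus.{u₀, u₁, u₄} k H) : Prop :=
  Nonempty (CoactionLift ρ ΩA.truncation ΩH.truncation)

/-- The horizontal one-forms `(Δ¹)⁻¹(Ω¹(A) ⊗ H)` of Đurđević. -/
noncomputable def horizontalD {ρ : A →ₐ[k] A ⊗[k] H} {ΓA : FODC.{u₀, u₂, u₃} k A}
    {ΓH : FODC.{u₀, u₁, u₄} k H} (Δ₁ : CoactionLift ρ ΓA ΓH) : Submodule k ΓA.Form :=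
  Submodule.comap (Δ₁.toLinearMap : ΓA.Form →ₗ[k] (ΓA.Form ⊗[k] H) × (A ⊗[k] ΓH.Form))
    (LinearMap.range (LinearMap.inl k (ΓA.Form ⊗[k] H) (A ⊗[k] ΓH.Form)))

end Bundles

end QPB

/-! Write a lift Δ¹ of the coaction as a pair of components. The first sends `a d a'` to a₀ da'₀ ⊗
a₁a'₁ in Ω¹(A) ⊗ H, the second sends it to a₀a'₀ ⊗ a₁ da'₁ in A ⊗ Ω¹(H). A linear map is a morphism
of calculi as soon as it is right on the forms `a d a'` (`FODC.Hom.ofSmulD`), so a lift amounts to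
two well-defined linear maps given by these formulas.

The first component is exactly a right covariant structure on Ω¹(A). The second is the vertical map
in other coordinates: the shear x ⊗ ω ↦ x₀ ⊗ x₁ω on A ⊗ Ω¹(H) is bijective, with inverse x ⊗ ω ↦ x₀
⊗ S(x₁)ω, and it carries a a'₀ ⊗ ϖ(a'₁) to a₀a'₀ ⊗ a₁a'₁S(a'₂) da'₃ = a₀a'₀ ⊗ a₁ da'₁
(`FODC.shear_mulLeft_maurerCartan`).

Hence a bundle yields a lift: take the covariant coaction together with the sheared vertical map.
The maximal prolongation has the same one-forms as the calculus it comes from, so this settles the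
first claim.

Conversely, a lift yields right covariance and, after undoing the shear, a vertical map whose kernel
is the kernel of the second component, which is the space of Đurđević's horizontal forms
(`CoactionLift.ker_snd_eq`, `CoactionLift.horizontalD_eq_ker`). This map takes values in A ⊗ Λ¹ and
is onto because the canonical map is onto and ϖ : H → Λ¹ is onto (`CoactionLift.exists_ver`). The
only condition left for a bundle is exactness in the middle, which is the equality of the two spaces
of horizontal forms. -/

namespace QPB

/-! ### Twisting V ⊗ N by the coaction of V and the H-action on N. -/

section Twist

variable {k : Type*} [Field k] {H : Type*} [Ring H] [HopfAlgebra k H]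
  {V N : Type*} [AddCommGroup V] [Module k V] [AddCommGroup N] [Module k N]

/-- The map `x ⊗ η ↦ x₀ ⊗ f(x₁) η`. -/
noncomputable def twist (δ : V →ₗ[k] V ⊗[k] H) (f : H →ₗ[k] Module.End k N) :
    V ⊗[k] N →ₗ[k] V ⊗[k] N :=
  TensorProduct.map LinearMap.id (TensorProduct.lift f) ∘ₗ TensorProduct.assoc k V H N ∘ₗ
    TensorProduct.map δ LinearMap.id

theorem twist_tmul (δ : V →ₗ[k] V ⊗[k] H) (f : H →ₗ[k] Module.End k N) (x : V) (η : N) :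
    twist δ f (x ⊗ₜ η) = TensorProduct.map LinearMap.id (f.flip η) (δ x) := by
  simp only [twist, LinearMap.comp_apply, TensorProduct.map_tmul, LinearMap.id_apply]
  induction δ x with
  | zero => simp
  | add y z hy hz => simp only [TensorProduct.add_tmul, map_add, hy, hz]
  | tmul v h => simp

/-- The map `h ↦ f(h₁) F(h₂)`. -/
noncomputable def convAct (f : H →ₗ[k] Module.End k N) (F : H →ₗ[k] N) : H →ₗ[k] N :=
  TensorProduct.lift (f.compl₂ F) ∘ₗ Coalgebra.comul (R := k)

/-- Coassociativity: twisting x₀ ⊗ F(x₁) gives x₀ ⊗ f(x₁)F(x₂), so twists compose as convolutions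
do. All later shear identities are instances of this. -/
theorem twist_map {δ : V →ₗ[k] V ⊗[k] H} (hδ : IsRightCoaction δ) (f : H →ₗ[k] Module.End k N)
    (F : H →ₗ[k] N) (x : V) :
    twist δ f (TensorProduct.map LinearMap.id F (δ x)) =
      TensorProduct.map LinearMap.id (convAct f F) (δ x) := by
  have h₁ : ∀ y : V ⊗[k] H, twist δ f (TensorProduct.map LinearMap.id F y) =
      TensorProduct.map LinearMap.id (TensorProduct.lift (f.compl₂ F))
        (TensorProduct.assoc k V H H (TensorProduct.map δ LinearMap.id y)) := by
    intro y
    induction y with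
    | zero => simp
    | add y z hy hz => simp only [map_add, hy, hz]
    | tmul v h =>
      simp only [TensorProduct.map_tmul, LinearMap.id_apply, twist_tmul]
      induction δ v with
      | zero => simp
      | add y z hy hz => simp only [TensorProduct.add_tmul, map_add, hy, hz]
      | tmul v h => simp
  have h₂ := LinearMap.congr_fun hδ.coassoc x
  simp only [LinearMap.comp_apply, LinearEquiv.coe_coe] at h₂
  rw [h₁, h₂, ← LinearMap.comp_apply, ← TensorProduct.map_comp, LinearMap.id_comp]
  rfl

theorem map_counit_smul {δ : V →ₗ[k] V ⊗[k] H} (hδ : IsRightCoaction δ) (η : N) (x : V) :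
    TensorProduct.map LinearMap.id ((Coalgebra.counit (R := k) (A := H)).smulRight η) (δ x) =
      x ⊗ₜ η := by
  have h₁ : ∀ y : V ⊗[k] H, TensorProduct.map LinearMap.id
      ((Coalgebra.counit (R := k) (A := H)).smulRight η) y =
      (TensorProduct.rid k V (TensorProduct.map LinearMap.id
        (Coalgebra.counit (R := k) (A := H)) y)) ⊗ₜ[k] η := by
    intro y
    induction y with
    | zero => simp
    | add y z hy hz => simp only [map_add, hy, hz, TensorProduct.add_tmul]
    | tmul v h => simp [TensorProduct.smul_tmul]
  have h₂ := LinearMap.congr_fun hδ.counit x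
  simp only [LinearMap.comp_apply, LinearEquiv.coe_coe, LinearMap.id_apply] at h₂
  rw [h₁, h₂]

/-- Since `act` is multiplicative, h₁ · (S(h₂) · η) is the action of h₁S(h₂) = ε(h)1. With its
mirror image below, this makes the twist by the antipode a two-sided inverse. -/
theorem convAct_antipode_right (act : H →ₐ[k] Module.End k N) (η : N) :
    convAct act.toLinearMap ((act.toLinearMap ∘ₗ HopfAlgebra.antipode k).flip η) =
      (Coalgebra.counit (R := k) (A := H)).smulRight η := by
  ext h
  have h₁ : ∀ y : H ⊗[k] H, TensorProduct.lift (act.toLinearMap.compl₂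
      ((act.toLinearMap ∘ₗ HopfAlgebra.antipode k).flip η)) y =
      act (LinearMap.mul' k H ((HopfAlgebra.antipode k).lTensor H y)) η := by
    intro y
    induction y with
    | zero => simp
    | add y z hy hz => simp only [map_add, hy, hz, LinearMap.add_apply]
    | tmul v h => simp
  rw [convAct, LinearMap.comp_apply, h₁, HopfAlgebra.mul_antipode_lTensor_comul_apply]
  simp [Module.algebraMap_end_apply]

theorem convAct_antipode_left (act : H →ₐ[k] Module.End k N) (η : N) :
    convAct (act.toLinearMap ∘ₗ HopfAlgebra.antipode k) (act.toLinearMap.flip η) =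
      (Coalgebra.counit (R := k) (A := H)).smulRight η := by
  ext h
  have h₁ : ∀ y : H ⊗[k] H, TensorProduct.lift
      ((act.toLinearMap ∘ₗ HopfAlgebra.antipode k).compl₂ (act.toLinearMap.flip η)) y =
      act (LinearMap.mul' k H ((HopfAlgebra.antipode k).rTensor H y)) η := by
    intro y
    induction y with
    | zero => simp
    | add y z hy hz => simp only [map_add, hy, hz, LinearMap.add_apply]
    | tmul v h => simp
  rw [convAct, LinearMap.comp_apply, h₁, HopfAlgebra.mul_antipode_rTensor_comul_apply]
  simp [Module.algebraMap_end_apply]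

/-- For a right comodule `V` and a left `H`-module `N`, the bijection `x ⊗ η ↦ x₀ ⊗ x₁ η`, with
inverse `x ⊗ η ↦ x₀ ⊗ S(x₁) η`. -/
noncomputable def twistEquiv {δ : V →ₗ[k] V ⊗[k] H} (hδ : IsRightCoaction δ)
    (act : H →ₐ[k] Module.End k N) : V ⊗[k] N ≃ₗ[k] V ⊗[k] N :=
  LinearEquiv.ofLinearMap (twist δ act.toLinearMap)
    (twist δ (act.toLinearMap ∘ₗ HopfAlgebra.antipode k))
    -- x₀ ⊗ x₁S(x₂)η = x₀ε(x₁) ⊗ η = x ⊗ η; the other composite uses S(x₁)x₂ instead.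
    (TensorProduct.ext' fun x η => by
      rw [LinearMap.comp_apply, twist_tmul, twist_map hδ, convAct_antipode_right,
        map_counit_smul hδ, LinearMap.id_apply])
    (TensorProduct.ext' fun x η => by
      rw [LinearMap.comp_apply, twist_tmul, twist_map hδ, convAct_antipode_left,
        map_counit_smul hδ, LinearMap.id_apply])

theorem twistEquiv_tmul {δ : V →ₗ[k] V ⊗[k] H} (hδ : IsRightCoaction δ)
    (act : H →ₐ[k] Module.End k N) (x : V) (η : N) :
    twistEquiv hδ act (x ⊗ₜ η) =
      TensorProduct.map LinearMap.id (act.toLinearMap.flip η) (δ x) := twist_tmul _ _ _ _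

theorem isRightCoaction_comul : IsRightCoaction (Bialgebra.comulAlgHom k H).toLinearMap where
  coassoc := Coalgebra.coassoc
  counit := by
    ext h
    have := Coalgebra.lTensor_counit_comul (R := k) h
    change TensorProduct.rid k H ((Coalgebra.counit (R := k) (A := H)).lTensor H
      (Coalgebra.comul (R := k) h)) = h
    rw [this]
    simp

/-- Counitality. It brings an identity between elements h₁ ⊗ F(h₂) of H ⊗ N back to an identity
between the maps F themselves. -/
theorem lid_counit_comul (F : H →ₗ[k] N) (h : H) :
    TensorProduct.lid k N (TensorProduct.map (Coalgebra.counit (R := k) (A := H)) LinearMap.id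
      (TensorProduct.map LinearMap.id F (Coalgebra.comul (R := k) h))) = F h := by
  have h₁ : ∀ y : H ⊗[k] H, TensorProduct.lid k N
      (TensorProduct.map (Coalgebra.counit (R := k) (A := H)) LinearMap.id
        (TensorProduct.map LinearMap.id F y)) =
      F (TensorProduct.lid k H ((Coalgebra.counit (R := k) (A := H)).rTensor H y)) := by
    intro y
    induction y with
    | zero => simp
    | add y z hy hz => simp only [map_add, hy, hz]
    | tmul v h => simp
  rw [h₁, Coalgebra.rTensor_counit_comul]
  simp

/-- The twist of h₁ ⊗ F(h₂) depends only on the convolution of the action with F. As the twist is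
bijective, h₁ ⊗ F(h₂) can be recovered, and the counit then gives F. -/
theorem convAct_injective (act : H →ₐ[k] Module.End k N) :
    Function.Injective (convAct act.toLinearMap) := by
  intro F G hFG
  ext h
  have h₁ : twistEquiv isRightCoaction_comul act
      (TensorProduct.map LinearMap.id F (Bialgebra.comulAlgHom k H h)) =
      twistEquiv isRightCoaction_comul act
        (TensorProduct.map LinearMap.id G (Bialgebra.comulAlgHom k H h)) := by
    have e := twist_map (isRightCoaction_comul (k := k) (H := H)) act.toLinearMap
    exact (e F h).trans (hFG ▸ (e G h).symm)
  have h₂ := (twistEquiv isRightCoaction_comul act).injective h₁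
  rw [← lid_counit_comul F h, ← lid_counit_comul G h]
  exact congrArg (fun y => TensorProduct.lid k N
    (TensorProduct.map (Coalgebra.counit (R := k) (A := H)) LinearMap.id y)) h₂

end Twist

/-! ### The Maurer–Cartan form and the left coinvariant one-forms. -/

section MaurerCartan

variable {k : Type u₀} [Field k] {H : Type u₁} [Ring H] [HopfAlgebra k H]
  {A : Type u₂} [Ring A] [Algebra k A]

theorem FODC.linearMap_ext {Γ : FODC.{u₀, u₂, u₃} k A} {W : Type*} [AddCommGroup W] [Module k W]
    {f g : Γ.Form →ₗ[k] W} (h : ∀ a b : A, f (a • Γ.d b) = g (a • Γ.d b)) : f = g :=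
  LinearMap.ext_on Γ.span_eq_top (by rintro _ ⟨a, b, rfl⟩; exact h a b)

/-- Recognising ϖ as the convolution of S with d is what puts it within reach of `twist_map`. -/
theorem FODC.convAct_antipode_d (Γ : FODC.{u₀, u₁, u₃} k H) :
    convAct ((Algebra.lsmul k k Γ.Form).toLinearMap ∘ₗ HopfAlgebra.antipode k) Γ.d =
      Γ.maurerCartan := rfl

/-- The bijection `x ⊗ ω ↦ x₀ ⊗ x₁ ω` of `A ⊗ Γ` for a comodule algebra `A` and a calculus `Γ`. -/
noncomputable def FODC.shear (Γ : FODC.{u₀, u₁, u₃} k H) {ρ : A →ₐ[k] A ⊗[k] H}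
    (hρ : IsRightCoaction ρ.toLinearMap) : A ⊗[k] Γ.Form ≃ₗ[k] A ⊗[k] Γ.Form :=
  twistEquiv hρ (Algebra.lsmul k k Γ.Form)

variable (Γ : FODC.{u₀, u₁, u₃} k H) {ρ : A →ₐ[k] A ⊗[k] H}
  (hρ : IsRightCoaction ρ.toLinearMap)

/-- The inverse shear twists by S, hence takes a₀ ⊗ da₁ to a₀ ⊗ S(a₁) da₂ = a₀ ⊗ ϖ(a₁). -/
theorem FODC.shear_maurerCartan (a : A) :
    Γ.shear hρ (TensorProduct.map LinearMap.id Γ.maurerCartan (ρ a)) =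
      TensorProduct.map LinearMap.id Γ.d (ρ a) := by
  rw [← (Γ.shear hρ).eq_symm_apply, ← Γ.convAct_antipode_d]
  exact (twist_map hρ _ Γ.d a).symm

/-- Multiplicativity of ρ: the shear of ax ⊗ ω is a₀x₀ ⊗ a₁x₁ω. -/
theorem FODC.shear_mulLeft (a : A) (y : A ⊗[k] Γ.Form) :
    Γ.shear hρ (TensorProduct.map (LinearMap.mulLeft k a) LinearMap.id y) =
      tensorLeftAct k A H A Γ.Form (ρ a) (Γ.shear hρ y) := by
  induction y with
  | zero => simp
  | add y z hy hz => simp only [map_add, hy, hz]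
  | tmul x ω =>
    rw [TensorProduct.map_tmul, FODC.shear, twistEquiv_tmul, twistEquiv_tmul]
    simp only [LinearMap.mulLeft_apply, LinearMap.id_apply, AlgHom.toLinearMap_apply, map_mul]
    induction ρ x with
    | zero => simp
    | add y z hy hz => simp only [map_add, mul_add, hy, hz]
    | tmul x g =>
      induction ρ a with
      | zero => simp
      | add y z hy hz => simp only [map_add, add_mul, LinearMap.add_apply, hy, hz]
      | tmul a h => simp

/-- `a a'₀ ⊗ ϖ(a'₁)` is sent to `a₀ a'₀ ⊗ a₁ d a'₁`. -/
theorem FODC.shear_mulLeft_maurerCartan (a a' : A) :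
    Γ.shear hρ (TensorProduct.map (LinearMap.mulLeft k a) Γ.maurerCartan (ρ a')) =
      tensorLeftAct k A H A Γ.Form (ρ a) (TensorProduct.map LinearMap.id Γ.d (ρ a')) := by
  rw [← Γ.shear_maurerCartan hρ a', ← Γ.shear_mulLeft hρ, ← LinearMap.comp_apply,
    ← TensorProduct.map_comp, LinearMap.comp_id, LinearMap.id_comp]

/-- `h₁ ϖ(h₂) = d h`. -/
theorem FODC.convAct_maurerCartan :
    convAct (Algebra.lsmul k k Γ.Form).toLinearMap Γ.maurerCartan = Γ.d := by
  ext h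
  have h₁ := Γ.shear_maurerCartan (isRightCoaction_comul (k := k) (H := H)) h
  have h₂ := twist_map (isRightCoaction_comul (k := k) (H := H))
    (Algebra.lsmul k k Γ.Form).toLinearMap Γ.maurerCartan h
  rw [← lid_counit_comul (convAct _ _) h, ← lid_counit_comul Γ.d h]
  exact congrArg (fun y => TensorProduct.lid k Γ.Form
    (TensorProduct.map (Coalgebra.counit (R := k) (A := H)) LinearMap.id y)) (h₂.symm.trans h₁)

variable {Γ}

theorem LeftCovariance.coact_smul (L : LeftCovariance Γ) (h : H) (ω : Γ.Form) :
    L.coact (h • ω) =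
      tensorLeftAct k H H H Γ.Form (Coalgebra.comul (R := k) h) (L.coact ω) := by
  have h₁ := L.map_bimodule h 1 ω
  rw [MulOpposite.op_one, one_smul, Bialgebra.comul_one, MulOpposite.op_one,
    map_one] at h₁
  exact h₁

/-- By `convAct_injective` it suffices to compare after convolving with the diagonal action of H on
H ⊗ Γ. One side becomes the coaction of g₁ϖ(g₂) = dg, which is g₁ ⊗ dg₂; the other is g₁ ⊗ g₂ϖ(g₃),
again g₁ ⊗ dg₂. No formula for the coproduct of S(h) is needed. -/
theorem LeftCovariance.coact_maurerCartan (L : LeftCovariance Γ) (h : H) :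
    L.coact (Γ.maurerCartan h) = 1 ⊗ₜ[k] Γ.maurerCartan h := by
  suffices h₁ : L.coact ∘ₗ Γ.maurerCartan = TensorProduct.mk k H Γ.Form 1 ∘ₗ Γ.maurerCartan from
    LinearMap.congr_fun h₁ h
  -- The diagonal action h · (g ⊗ ω) = h₁g ⊗ h₂ω, for which the left coaction of Γ is H-linear.
  let act : H →ₐ[k] Module.End k (H ⊗[k] Γ.Form) :=
    (tensorLeftAct k H H H Γ.Form).comp (Bialgebra.comulAlgHom k H)
  have hact : ∀ h x, act h x = tensorLeftAct k H H H Γ.Form (Coalgebra.comul (R := k) h) x :=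
    fun h x => rfl
  refine convAct_injective act ?_
  ext g
  have e₁ : convAct act.toLinearMap (L.coact ∘ₗ Γ.maurerCartan) g =
      L.coact (convAct (Algebra.lsmul k k Γ.Form).toLinearMap Γ.maurerCartan g) := by
    simp only [convAct, LinearMap.comp_apply]
    induction Coalgebra.comul (R := k) g with
    | zero => simp
    | add y z hy hz => simp only [map_add, hy, hz]
    | tmul x y => simp [hact, L.coact_smul]
  have e₂ : convAct act.toLinearMap (TensorProduct.mk k H Γ.Form 1 ∘ₗ Γ.maurerCartan) g =
      Γ.shear isRightCoaction_comul (TensorProduct.map LinearMap.id Γ.maurerCartan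
        (Bialgebra.comulAlgHom k H g)) := by
    simp only [convAct, LinearMap.comp_apply, Bialgebra.comulAlgHom_apply]
    induction Coalgebra.comul (R := k) g with
    | zero => simp
    | add y z hy hz => simp only [map_add, hy, hz]
    | tmul x y =>
      rw [TensorProduct.map_tmul, FODC.shear, twistEquiv_tmul]
      simp only [TensorProduct.lift.tmul, LinearMap.compl₂_apply, LinearMap.comp_apply,
        AlgHom.toLinearMap_apply, hact, Bialgebra.comulAlgHom_apply, TensorProduct.mk_apply]
      induction Coalgebra.comul (R := k) x with
      | zero => simp
      | add y z hy hz => simp only [map_add, LinearMap.add_apply, hy, hz]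
      | tmul a b => simp
  rw [e₁, e₂, Γ.convAct_maurerCartan, L.map_d, Γ.shear_maurerCartan]
  rfl

/-- The quantum Maurer–Cartan form as a map to the left coinvariant forms. -/
noncomputable def LeftCovariance.maurerCartan (L : LeftCovariance Γ) :
    H →ₗ[k] L.coinvariantForms :=
  Γ.maurerCartan.codRestrict L.coinvariantForms L.coact_maurerCartan

/-- Every form is a sum ∑ xϖ(y), because a db = ab₁ϖ(b₂). The coaction of such a sum is the shear of
∑ x ⊗ ϖ(y), and 1 ⊗ ω is its own shear. If ω is coinvariant, injectivity of the shear gives ∑ x ⊗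
ϖ(y) = 1 ⊗ ω, and the counit in the first factor exhibits ω as ϖ(∑ ε(x)y). -/
theorem LeftCovariance.maurerCartan_surjective (L : LeftCovariance Γ) :
    Function.Surjective L.maurerCartan := by
  rintro ⟨ω, hω⟩
  let m : H ⊗[k] Γ.Form →ₗ[k] Γ.Form := TensorProduct.lift (Algebra.lsmul k k Γ.Form).toLinearMap
  have hm : Function.Surjective (m ∘ₗ TensorProduct.map LinearMap.id Γ.maurerCartan) := by
    rw [← LinearMap.range_eq_top, eq_top_iff, ← Γ.span_eq_top, Submodule.span_le]
    rintro _ ⟨a, b, rfl⟩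
    refine ⟨TensorProduct.map (LinearMap.mulLeft k a) LinearMap.id
      (Coalgebra.comul (R := k) b), ?_⟩
    rw [← Γ.convAct_maurerCartan]
    simp only [convAct, LinearMap.comp_apply]
    induction Coalgebra.comul (R := k) b with
    | zero => simp
    | add y z hy hz => simp only [map_add, smul_add, hy, hz]
    | tmul x y => simp [m, smul_smul]
  obtain ⟨z, rfl⟩ := hm ω
  -- Coinvariance of ϖ(y) reduces the coaction of xϖ(y) to x₁ ⊗ x₂ϖ(y).
  have hz : ∀ z, L.coact (m (TensorProduct.map LinearMap.id Γ.maurerCartan z)) =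
      Γ.shear isRightCoaction_comul (TensorProduct.map LinearMap.id Γ.maurerCartan z) := by
    intro z
    induction z with
    | zero => simp
    | add y z hy hz => simp only [map_add, hy, hz]
    | tmul x y =>
      rw [TensorProduct.map_tmul, FODC.shear, twistEquiv_tmul]
      simp only [m, TensorProduct.lift.tmul, AlgHom.toLinearMap_apply, Algebra.lsmul_coe,
        LinearMap.id_apply, L.coact_smul, L.coact_maurerCartan, Bialgebra.comulAlgHom_apply]
      induction Coalgebra.comul (R := k) x with
      | zero => simp
      | add y z hy hz => simp only [map_add, LinearMap.add_apply, hy, hz]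
      | tmul a b => simp
  have hone : ∀ ω : Γ.Form, Γ.shear isRightCoaction_comul (1 ⊗ₜ[k] ω) = (1 : H) ⊗ₜ[k] ω := by
    intro ω
    rw [FODC.shear, twistEquiv_tmul, AlgHom.toLinearMap_apply, map_one,
      Algebra.TensorProduct.one_def]
    simp
  have h₁ : TensorProduct.map LinearMap.id Γ.maurerCartan z = (1 : H) ⊗ₜ[k]
      m (TensorProduct.map LinearMap.id Γ.maurerCartan z) := by
    refine (Γ.shear (isRightCoaction_comul (k := k) (H := H))).injective ?_
    rw [hone, ← hz]
    exact hω
  refine ⟨TensorProduct.lid k H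
    (TensorProduct.map (Coalgebra.counit (R := k) (A := H)) LinearMap.id z), Subtype.ext ?_⟩
  have h₂ := congrArg (fun y => TensorProduct.lid k Γ.Form
    (TensorProduct.map (Coalgebra.counit (R := k) (A := H)) LinearMap.id y)) h₁
  simp only [TensorProduct.map_tmul, Bialgebra.counit_one, LinearMap.id_apply,
    TensorProduct.lid_tmul, one_smul] at h₂
  refine Eq.trans ?_ h₂
  change Γ.maurerCartan _ = _
  -- The remaining identity holds for every tensor z; the facts dropped here concern the chosen z
  -- only and would obstruct the induction.
  clear hω h₁ h₂
  induction z with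
  | zero => simp
  | add y z hy hz => simp only [map_add, hy, hz]
  | tmul x y => simp

end MaurerCartan

/-! ### Morphisms determined on the forms a db, and the one-forms of the maximal prolongation. -/

section Lifts

variable {k : Type u₀} [Field k] {A : Type u₁} [Ring A] [Algebra k A]
  {A' : Type u₂} [Ring A'] [Algebra k A']

/-- A linear map with `a d b ↦ φ(a) d φ(b)` is a morphism of first order calculi. -/
def FODC.Hom.ofSmulD {Γ : FODC.{u₀, u₁, u₃} k A} {Γ' : FODC.{u₀, u₂, u₄} k A'} {φ : A →ₐ[k] A'}
    (f : Γ.Form →ₗ[k] Γ'.Form) (hf : ∀ a b : A, f (a • Γ.d b) = φ a • Γ'.d (φ b)) :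
    FODC.Hom Γ Γ' φ where
  toLinearMap := f
  map_bimodule a b ω := by
    induction ω using Prolong.form_induction with
    | hadd x y hx hy => simp only [smul_add, map_add, hx, hy]
    | h c e =>
      -- The Leibniz rule trades right multiplication for forms of the generating shape: ac(de)b =
      -- ac d(eb) − ace db.
      have h₁ : a • op b • c • Γ.d e = (a * c) • Γ.d (e * b) - (a * c * e) • Γ.d b := by
        rw [Γ.leibniz, smul_add, smul_smul, add_sub_cancel_right, ← smul_comm c (op b), smul_smul]
      rw [h₁, map_sub, hf, hf, hf, map_mul φ e, map_mul φ (a * c), map_mul φ a, Γ'.leibniz, smul_add,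
        smul_smul, add_sub_cancel_right, ← smul_comm (φ c) (op (φ b)), smul_smul]
  map_d a := by simpa using hf 1 a

theorem FODC.Hom.map_smul_d {Γ : FODC.{u₀, u₁, u₃} k A} {Γ' : FODC.{u₀, u₂, u₄} k A'}
    {φ : A →ₐ[k] A'} (F : FODC.Hom Γ Γ' φ) (a b : A) :
    F.toLinearMap (a • Γ.d b) = φ a • Γ'.d (φ b) := by
  simpa [F.map_d] using F.map_bimodule a 1 (Γ.d b)

/-- The one-forms of the maximal prolongation of `Γ` are those of `Γ`. -/
noncomputable def maximalProlongationOneForm (Γ : FODC.{u₀, u₁, u₃} k A) :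
    Γ.Form ≃ₗ[k] (maximalProlongation Γ).truncation.Form :=
  LinearEquiv.ofBijective
    ((Prolong.ofForm Γ).codRestrict (Prolong.deg Γ 1) (Prolong.ofForm_mem Γ) :
      Γ.Form →ₗ[k] ↥(Prolong.deg Γ 1))
    ⟨fun _ _ h => Prolong.ofForm_injective Γ (congrArg Subtype.val h), fun ω => by
      obtain ⟨η, hη⟩ := (Prolong.range_ofForm Γ).ge ω.2
      exact ⟨η, Subtype.ext hη⟩⟩

theorem maximalProlongationOneForm_smul_d (Γ : FODC.{u₀, u₁, u₃} k A) (a b : A) :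
    maximalProlongationOneForm Γ (a • Γ.d b) =
      a • (maximalProlongation Γ).truncation.d b :=
  Subtype.ext ((Prolong.ofForm_left Γ a (Γ.d b)).trans
    (congrArg (Prolong.ofBase Γ a * ·) (Prolong.d_ofBase Γ b).symm))

theorem maximalProlongationOneForm_d (Γ : FODC.{u₀, u₁, u₃} k A) (b : A) :
    maximalProlongationOneForm Γ (Γ.d b) = (maximalProlongation Γ).truncation.d b :=
  Subtype.ext (Prolong.d_ofBase Γ b).symm

end Lifts

/-! ### From a Brzeziński–Majid bundle to a lift of the coaction. -/

section Bundles

variable {k : Type u₀} [Field k] {H : Type u₁} [Ring H] [HopfAlgebra k H]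
  {A : Type u₂} [Ring A] [Algebra k A] {ρ : A →ₐ[k] A ⊗[k] H}
  {ΓA : FODC.{u₀, u₂, u₃} k A} {ΓH : FODC.{u₀, u₁, u₄} k H}

theorem tensorLeftAct_map {B M M' N N' : Type*} [Ring B] [Algebra k B]
    [AddCommGroup M] [Module k M] [Module A M] [IsScalarTower k A M]
    [AddCommGroup M'] [Module k M'] [Module A M'] [IsScalarTower k A M']
    [AddCommGroup N] [Module k N] [Module B N] [IsScalarTower k B N]
    [AddCommGroup N'] [Module k N'] [Module B N'] [IsScalarTower k B N']
    (f : M →ₗ[k] M') (hf : ∀ (a : A) m, f (a • m) = a • f m)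
    (g : N →ₗ[k] N') (hg : ∀ (b : B) n, g (b • n) = b • g n) (s : A ⊗[k] B) (x : M ⊗[k] N) :
    TensorProduct.map f g (tensorLeftAct k A B M N s x) =
      tensorLeftAct k A B M' N' s (TensorProduct.map f g x) := by
  induction x with
  | zero => simp
  | add y z hy hz => simp only [map_add, hy, hz]
  | tmul m n =>
    induction s with
    | zero => simp
    | add y z hy hz => simp only [map_add, LinearMap.add_apply, hy, hz]
    | tmul a b => simp [hf, hg]

/-- Puts the formula for the vertical map in the form (id ⊗ ϖ)((a ⊗ 1)ρ(a')), where the second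
factor is a value of the canonical map. -/
theorem map_mulLeft {N : Type*} [AddCommGroup N] [Module k N] (F : H →ₗ[k] N) (a : A)
    (y : A ⊗[k] H) : TensorProduct.map (LinearMap.mulLeft k a) F y =
      TensorProduct.map LinearMap.id F (a ⊗ₜ[k] 1 * y) := by
  induction y with
  | zero => simp
  | add y z hy hz => simp only [map_add, mul_add, hy, hz]
  | tmul b h => simp

/-- The covariant coaction supplies the component in Γ_A ⊗ H, and the sheared vertical map the one
in A ⊗ Γ_H. Only the existence of the vertical map matters here, not the exactness of its sequence.
-/
theorem IsBrzezinskiMajidBundle.isFirstOrderComplete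
    (hρ : IsRightCoaction ρ.toLinearMap) (h : IsBrzezinskiMajidBundle ρ ΓA ΓH) :
    IsFirstOrderComplete ρ (maximalProlongation ΓA) (maximalProlongation ΓH) := by
  obtain ⟨⟨δ, -, hδ, hδd⟩, -, L, ver, hver, -, -⟩ := h
  have hδ' : ∀ a b, δ (a • ΓA.d b) = tensorLeftAct k A H ΓA.Form H (ρ a)
      (TensorProduct.map ΓA.d LinearMap.id (ρ b)) := by
    intro a b
    have h₁ := hδ a 1 (ΓA.d b)
    rw [MulOpposite.op_one, one_smul, map_one, MulOpposite.op_one, map_one, hδd] at h₁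
    exact h₁
  let eA := maximalProlongationOneForm ΓA
  let eH := maximalProlongationOneForm ΓH
  -- Well defined because `ver` is; on a db it equals a₀b₀ ⊗ a₁ db₁.
  let π : ΓA.Form →ₗ[k] A ⊗[k] ΓH.Form := (ΓH.shear hρ).toLinearMap ∘ₗ
    TensorProduct.map LinearMap.id L.coinvariantForms.subtype ∘ₗ ver
  have hπ : ∀ a b, π (a • ΓA.d b) = tensorLeftAct k A H A ΓH.Form (ρ a)
      (TensorProduct.map LinearMap.id ΓH.d (ρ b)) := by
    intro a b
    simp only [π, LinearMap.comp_apply, LinearEquiv.coe_coe, hver,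
      ΓH.shear_mulLeft_maurerCartan hρ]
  have heA : ∀ (a : A) ω, eA.toLinearMap (a • ω) = a • eA.toLinearMap ω := fun a ω =>
    Subtype.ext (Prolong.ofForm_left ΓA a ω)
  have heH : ∀ (a : H) ω, eH.toLinearMap (a • ω) = a • eH.toLinearMap ω := fun a ω =>
    Subtype.ext (Prolong.ofForm_left ΓH a ω)
  -- The pair of components is conjugated by the identifications `eA`, `eH` with the degree one
  -- parts of the prolongations.
  refine ⟨FODC.Hom.ofSmulD ((LinearMap.prod
    (TensorProduct.map eA.toLinearMap LinearMap.id ∘ₗ δ)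
    (TensorProduct.map LinearMap.id eH.toLinearMap ∘ₗ π)) ∘ₗ eA.symm.toLinearMap) ?_⟩
  intro a b
  have h₁ : eA.symm.toLinearMap (a • (maximalProlongation ΓA).truncation.d b) = a • ΓA.d b :=
    eA.symm_apply_eq.2 (maximalProlongationOneForm_smul_d ΓA a b).symm
  refine (congrArg (LinearMap.prod (TensorProduct.map eA.toLinearMap LinearMap.id ∘ₗ δ)
    (TensorProduct.map LinearMap.id eH.toLinearMap ∘ₗ π)) h₁).trans (Prod.ext ?_ ?_)
  · change TensorProduct.map eA.toLinearMap LinearMap.id (δ (a • ΓA.d b)) =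
      tensorLeftAct k A H _ H (ρ a)
        (TensorProduct.map (maximalProlongation ΓA).truncation.d LinearMap.id (ρ b))
    rw [hδ', tensorLeftAct_map _ heA _ fun _ _ => rfl, TensorProduct.map_map,
      LinearMap.id_comp]
    congr 3
    exact LinearMap.ext (maximalProlongationOneForm_d ΓA)
  · change TensorProduct.map LinearMap.id eH.toLinearMap (π (a • ΓA.d b)) =
      tensorLeftAct k A H A _ (ρ a)
        (TensorProduct.map LinearMap.id (maximalProlongation ΓH).truncation.d (ρ b))
    rw [hπ, tensorLeftAct_map _ (fun _ _ => rfl) _ heH, TensorProduct.map_map,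
      LinearMap.id_comp]
    congr 3
    exact LinearMap.ext (maximalProlongationOneForm_d ΓH)

/-! ### From a lift of the coaction to covariance and the vertical map. -/

namespace CoactionLift

variable (Δ₁ : CoactionLift ρ ΓA ΓH)

/-- The component `Ω¹(A) → Ω¹(A) ⊗ H` of a lift of the coaction. -/
noncomputable def fst : ΓA.Form →ₗ[k] ΓA.Form ⊗[k] H :=
  LinearMap.fst k (ΓA.Form ⊗[k] H) (A ⊗[k] ΓH.Form) ∘ₗ Δ₁.toLinearMap

/-- The component `Ω¹(A) → A ⊗ Ω¹(H)` of a lift of the coaction. -/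
noncomputable def snd : ΓA.Form →ₗ[k] A ⊗[k] ΓH.Form :=
  LinearMap.snd k (ΓA.Form ⊗[k] H) (A ⊗[k] ΓH.Form) ∘ₗ Δ₁.toLinearMap

theorem fst_bimodule (a b : A) (ω : ΓA.Form) : fst Δ₁ (a • op b • ω) =
    tensorLeftAct k A H ΓA.Form H (ρ a)
      (tensorRightAct k A H ΓA.Form H (op (ρ b)) (fst Δ₁ ω)) :=
  congrArg Prod.fst (Δ₁.map_bimodule a b ω)

theorem fst_d (a : A) : fst Δ₁ (ΓA.d a) = TensorProduct.map ΓA.d LinearMap.id (ρ a) :=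
  congrArg Prod.fst (Δ₁.map_d a)

theorem fst_smul (a : A) (ω : ΓA.Form) :
    fst Δ₁ (a • ω) = tensorLeftAct k A H ΓA.Form H (ρ a) (fst Δ₁ ω) := by
  have h₁ := fst_bimodule Δ₁ a 1 ω
  rw [MulOpposite.op_one, one_smul, map_one, MulOpposite.op_one, map_one] at h₁
  exact h₁

theorem snd_smul_d (a b : A) : snd Δ₁ (a • ΓA.d b) =
    tensorLeftAct k A H A ΓH.Form (ρ a) (TensorProduct.map LinearMap.id ΓH.d (ρ b)) :=
  congrArg Prod.snd (Δ₁.map_smul_d a b)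

theorem horizontalD_eq_ker : horizontalD Δ₁ = LinearMap.ker (snd Δ₁) := by
  ext ω
  constructor
  · rintro ⟨x, hx⟩
    exact (congrArg Prod.snd hx).symm
  · intro hω
    exact ⟨fst Δ₁ ω, Prod.ext rfl (LinearMap.mem_ker.1 hω).symm⟩

/-- The first component is ρ-linear and intertwines d, so on forms a db both coaction axioms reduce
to those of ρ at a and at b. -/
theorem isRightCoaction_fst (hρ : IsRightCoaction ρ.toLinearMap) :
    IsRightCoaction (fst Δ₁) where
  coassoc := by
    -- This and `hcomul` show that both iterated coactions respect left multiplication, with values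
    -- in A ⊗ H ⊗ H; the two multipliers agree by coassociativity of ρ.
    have hmap : ∀ (s : A ⊗[k] H) (x : ΓA.Form ⊗[k] H),
        TensorProduct.assoc k ΓA.Form H H (TensorProduct.map (fst Δ₁) LinearMap.id
          (tensorLeftAct k A H ΓA.Form H s x)) =
        tensorLeftAct k A (H ⊗[k] H) ΓA.Form (H ⊗[k] H)
          (TensorProduct.assoc k A H H (TensorProduct.map ρ.toLinearMap LinearMap.id s))
          (TensorProduct.assoc k ΓA.Form H H
            (TensorProduct.map (fst Δ₁) LinearMap.id x)) := by
      intro s x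
      induction s with
      | zero => simp
      | add y z hy hz => simp only [map_add, LinearMap.add_apply, hy, hz]
      | tmul a h =>
        induction x with
        | zero => simp
        | add y z hy hz => simp only [map_add, hy, hz]
        | tmul ω g =>
          rw [tensorLeftAct_tmul, TensorProduct.map_tmul, TensorProduct.map_tmul,
            TensorProduct.map_tmul, fst_smul, AlgHom.toLinearMap_apply]
          induction ρ a with
          | zero => simp
          | add y z hy hz =>
            simp only [map_add, LinearMap.add_apply, TensorProduct.add_tmul, hy, hz]
          | tmul a' h' =>
            induction fst Δ₁ ω with
            | zero => simp
            | add y z hy hz => simp only [map_add, TensorProduct.add_tmul, hy, hz]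
            | tmul ω' g' => simp
    have hcomul : ∀ (s : A ⊗[k] H) (x : ΓA.Form ⊗[k] H),
        TensorProduct.map LinearMap.id (Coalgebra.comul (R := k))
          (tensorLeftAct k A H ΓA.Form H s x) =
        tensorLeftAct k A (H ⊗[k] H) ΓA.Form (H ⊗[k] H)
          (TensorProduct.map LinearMap.id (Coalgebra.comul (R := k)) s)
          (TensorProduct.map LinearMap.id (Coalgebra.comul (R := k)) x) := by
      intro s x
      induction s with
      | zero => simp
      | add y z hy hz => simp only [map_add, LinearMap.add_apply, hy, hz]
      | tmul a h =>
        induction x with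
        | zero => simp
        | add y z hy hz => simp only [map_add, hy, hz]
        | tmul ω g => simp
    have hd : ∀ s : A ⊗[k] H, TensorProduct.assoc k ΓA.Form H H
        (TensorProduct.map (fst Δ₁) LinearMap.id (TensorProduct.map ΓA.d LinearMap.id s)) =
        TensorProduct.map ΓA.d LinearMap.id (TensorProduct.assoc k A H H
          (TensorProduct.map ρ.toLinearMap LinearMap.id s)) := by
      intro s
      induction s with
      | zero => simp
      | add y z hy hz => simp only [map_add, hy, hz]
      | tmul a h =>
        simp only [TensorProduct.map_tmul, fst_d, AlgHom.toLinearMap_apply, LinearMap.id_apply]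
        induction ρ a with
        | zero => simp
        | add y z hy hz => simp only [map_add, TensorProduct.add_tmul, hy, hz]
        | tmul a' h' => simp
    refine FODC.linearMap_ext fun a b => ?_
    have ha := LinearMap.congr_fun hρ.coassoc a
    have hb := LinearMap.congr_fun hρ.coassoc b
    simp only [LinearMap.comp_apply, LinearEquiv.coe_coe, AlgHom.toLinearMap_apply] at ha hb ⊢
    rw [fst_smul, fst_d, hmap, hcomul, hd, ha, hb]
    congr 1
    simp only [← LinearMap.comp_apply, ← TensorProduct.map_comp, LinearMap.id_comp,
      LinearMap.comp_id]
  counit := by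
    -- The counit is multiplicative, so id ⊗ ε turns the action of A ⊗ H into that of A.
    have hmul : ∀ (s : A ⊗[k] H) (x : ΓA.Form ⊗[k] H),
        TensorProduct.rid k ΓA.Form (TensorProduct.map LinearMap.id
          (Coalgebra.counit (R := k) (A := H)) (tensorLeftAct k A H ΓA.Form H s x)) =
        TensorProduct.rid k A (TensorProduct.map LinearMap.id
          (Coalgebra.counit (R := k) (A := H)) s) •
        TensorProduct.rid k ΓA.Form (TensorProduct.map LinearMap.id
          (Coalgebra.counit (R := k) (A := H)) x) := by
      intro s x
      induction s with
      | zero => simp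
      | add y z hy hz => simp only [map_add, LinearMap.add_apply, add_smul, hy, hz]
      | tmul a h =>
        induction x with
        | zero => simp
        | add y z hy hz => simp only [map_add, smul_add, hy, hz]
        | tmul ω g =>
          simp only [tensorLeftAct_tmul, TensorProduct.map_tmul, LinearMap.id_apply,
            TensorProduct.rid_tmul, smul_eq_mul, Bialgebra.counit_mul, mul_smul, smul_assoc]
          rw [smul_algebra_smul_comm (Coalgebra.counit (R := k) g) a ω]
    have hd : ∀ s : A ⊗[k] H, TensorProduct.rid k ΓA.Form (TensorProduct.map LinearMap.id
        (Coalgebra.counit (R := k) (A := H)) (TensorProduct.map ΓA.d LinearMap.id s)) =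
        ΓA.d (TensorProduct.rid k A (TensorProduct.map LinearMap.id
          (Coalgebra.counit (R := k) (A := H)) s)) := by
      intro s
      induction s with
      | zero => simp
      | add y z hy hz => simp only [map_add, hy, hz]
      | tmul a h => simp
    refine FODC.linearMap_ext fun a b => ?_
    have ha := LinearMap.congr_fun hρ.counit a
    have hb := LinearMap.congr_fun hρ.counit b
    simp only [LinearMap.comp_apply, LinearEquiv.coe_coe, AlgHom.toLinearMap_apply,
      LinearMap.id_apply] at ha hb ⊢
    rw [fst_smul, fst_d, hmul, hd, ha, hb]

theorem isRightCovariant (Δ₁ : CoactionLift ρ ΓA ΓH) (hρ : IsRightCoaction ρ.toLinearMap) :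
    ΓA.IsRightCovariant ρ :=
  ⟨fst Δ₁, isRightCoaction_fst Δ₁ hρ, fst_bimodule Δ₁, fst_d Δ₁⟩

/-- On a linear map `ver` with `ver (a d a') = a a'₀ ⊗ ϖ(a'₁)`, the vertical component of the lift
is `ver` up to the bijection `x ⊗ ω ↦ x₀ ⊗ x₁ ω`. -/
theorem ker_snd_eq (Δ₁ : CoactionLift ρ ΓA ΓH) (hρ : IsRightCoaction ρ.toLinearMap)
    (L : LeftCovariance ΓH) (ver : ΓA.Form →ₗ[k] A ⊗[k] L.coinvariantForms)
    (hver : ∀ a a' : A, TensorProduct.map LinearMap.id L.coinvariantForms.subtype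
        (ver (a • ΓA.d a')) =
      TensorProduct.map (LinearMap.mulLeft k a) ΓH.maurerCartan (ρ a')) :
    LinearMap.ker (snd Δ₁) = LinearMap.ker ver := by
  have h₁ : snd Δ₁ = ((ΓH.shear hρ).toLinearMap ∘ₗ
      TensorProduct.map LinearMap.id L.coinvariantForms.subtype) ∘ₗ ver := by
    refine FODC.linearMap_ext fun a b => ?_
    simp only [LinearMap.comp_apply, LinearEquiv.coe_coe, hver,
      ΓH.shear_mulLeft_maurerCartan hρ, snd_smul_d]
  -- The inclusion of Λ¹ stays injective after tensoring over the field with A, and the shear is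
  -- bijective; composing with them leaves the kernel of `ver` unchanged.
  have h₂ : Function.Injective ((ΓH.shear hρ).toLinearMap ∘ₗ
      TensorProduct.map (LinearMap.id (M := A)) L.coinvariantForms.subtype) :=
    (ΓH.shear hρ).injective.comp (Module.Flat.lTensor_preserves_injective_linearMap
      L.coinvariantForms.subtype L.coinvariantForms.injective_subtype)
  rw [h₁, LinearMap.ker_comp_of_ker_eq_bot _ (LinearMap.ker_eq_bot.2 h₂)]

/-- Undoing the shear on the second component gives a map into A ⊗ Γ_H that is well defined because
the lift is. On generators it is (id ⊗ ϖ) applied to the canonical map, so it lands in A ⊗ Λ¹ and is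
onto when the canonical map is. -/
theorem exists_ver (Δ₁ : CoactionLift ρ ΓA ΓH) (hρ : IsRightCoaction ρ.toLinearMap)
    (hgal : Function.Surjective (canonicalMap ρ)) (L : LeftCovariance ΓH) :
    ∃ ver : ΓA.Form →ₗ[k] A ⊗[k] L.coinvariantForms,
      (∀ a a' : A, TensorProduct.map LinearMap.id L.coinvariantForms.subtype
          (ver (a • ΓA.d a')) =
        TensorProduct.map (LinearMap.mulLeft k a) ΓH.maurerCartan (ρ a')) ∧
      Function.Surjective ver := by
  let ι := TensorProduct.map (LinearMap.id (R := k) (M := A)) L.coinvariantForms.subtype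
  have hι : Function.Injective ι := Module.Flat.lTensor_preserves_injective_linearMap
    L.coinvariantForms.subtype L.coinvariantForms.injective_subtype
  let v : ΓA.Form →ₗ[k] A ⊗[k] ΓH.Form := (ΓH.shear hρ).symm.toLinearMap ∘ₗ snd Δ₁
  have hv : ∀ a a', v (a • ΓA.d a') =
      TensorProduct.map (LinearMap.mulLeft k a) ΓH.maurerCartan (ρ a') := by
    intro a a'
    refine (ΓH.shear hρ).symm_apply_eq.2 ?_
    rw [snd_smul_d, ΓH.shear_mulLeft_maurerCartan hρ]
  have hmc : ∀ a a', ι (TensorProduct.map (LinearMap.mulLeft k a) L.maurerCartan (ρ a')) =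
      TensorProduct.map (LinearMap.mulLeft k a) ΓH.maurerCartan (ρ a') := by
    intro a a'
    rw [← LinearMap.comp_apply, ← TensorProduct.map_comp]
    rfl
  -- Membership need only be checked on forms a da', whose image a a'₀ ⊗ ϖ(a'₁) visibly lies in A ⊗
  -- Λ¹.
  have hmem : ∀ ω, v ω ∈ LinearMap.range ι := by
    intro ω
    induction ω using Prolong.form_induction with
    | h a b => exact ⟨_, (hmc a b).trans (hv a b).symm⟩
    | hadd x y hx hy => rw [map_add]; exact Submodule.add_mem _ hx hy
  let ver : ΓA.Form →ₗ[k] A ⊗[k] L.coinvariantForms :=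
    (LinearEquiv.ofInjective ι hι).symm.toLinearMap ∘ₗ v.codRestrict (LinearMap.range ι) hmem
  have hver : ∀ ω, ι (ver ω) = v ω := fun ω =>
    congrArg Subtype.val ((LinearEquiv.ofInjective ι hι).apply_symm_apply ⟨v ω, hmem ω⟩)
  refine ⟨ver, fun a a' => (hver _).trans (hv a a'), ?_⟩
  have hver' : ∀ a a', ver (a • ΓA.d a') =
      TensorProduct.map LinearMap.id L.maurerCartan (a ⊗ₜ[k] 1 * ρ a') := fun a a' => by
    rw [← map_mulLeft]
    exact hι (((hver _).trans (hv a a')).trans (hmc a a').symm)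
  -- The class of a ⊗ a' is matched by the form a da'. Membership in the range is additive, so
  -- representatives in A ⊗ A over ℤ suffice and no map from A ⊗_B A to the forms has to be built.
  have hcan : ∀ t, TensorProduct.map LinearMap.id L.maurerCartan (canonicalMap ρ t) ∈
      LinearMap.range ver := by
    intro t
    obtain ⟨t, rfl⟩ := QuotientAddGroup.mk_surjective t
    induction t with
    | zero =>
      have h₁ : canonicalMap ρ (QuotientAddGroup.mk (0 : A ⊗[ℤ] A)) = 0 :=
        map_zero (canonicalMap ρ)
      rw [h₁, map_zero]
      exact Submodule.zero_mem _
    | add y z hy hz =>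
      have h₁ : canonicalMap ρ (QuotientAddGroup.mk (y + z)) =
          canonicalMap ρ (QuotientAddGroup.mk y) + canonicalMap ρ (QuotientAddGroup.mk z) :=
        map_add (canonicalMap ρ) (QuotientAddGroup.mk y) (QuotientAddGroup.mk z)
      rw [h₁, map_add]
      exact Submodule.add_mem _ hy hz
    | tmul a a' => exact ⟨a • ΓA.d a', hver' a a'⟩
  intro y
  obtain ⟨x, rfl⟩ := TensorProduct.map_surjective
    (g := LinearMap.id (R := k) (M := A)) Function.surjective_id
    L.maurerCartan_surjective y
  obtain ⟨t, rfl⟩ := hgal x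
  exact hcan t

/-- `ker_snd_eq` holds for any left covariance and any vertical map, so the forward direction uses
those of the given bundle and needs no uniqueness. In the other direction the lift provides
everything except the middle exactness, which is the assumed equality. -/
theorem isBrzezinskiMajidBundle_iff (hρ : IsRightCoaction ρ.toLinearMap)
    (hgal : Function.Surjective (canonicalMap ρ)) (hH : ΓH.IsBicovariant) :
    IsBrzezinskiMajidBundle ρ ΓA ΓH ↔ horizontalBM ρ ΓA = horizontalD Δ₁ := by
  rw [horizontalD_eq_ker]
  constructor
  · rintro ⟨-, -, L, ver, hver, hker, -⟩
    rw [← hker, ker_snd_eq Δ₁ hρ L ver hver]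
  · intro h
    obtain ⟨⟨L⟩, hR⟩ := hH
    obtain ⟨ver, hver, hsurj⟩ := exists_ver Δ₁ hρ hgal L
    exact ⟨isRightCovariant Δ₁ hρ, hR, L, ver, hver,
      (ker_snd_eq Δ₁ hρ L ver hver).symm.trans h.symm, hsurj⟩

end CoactionLift

end Bundles

end QPB

theorem mainTheorem6 {k : Type u₀} [Field k] {H : Type u₁} [Ring H] [HopfAlgebra k H]
    {A : Type u₂} [Ring A] [Algebra k A] (ρ : A →ₐ[k] A ⊗[k] H)
    (hρ : QPB.IsFaithfullyFlatHopfGalois ρ) :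
    (∀ (ΓA : QPB.FODC.{u₀, u₂, u₃} k A) (ΓH : QPB.FODC.{u₀, u₁, u₄} k H),
      QPB.IsBrzezinskiMajidBundle ρ ΓA ΓH →
        QPB.IsFirstOrderComplete ρ (QPB.maximalProlongation ΓA) (QPB.maximalProlongation ΓH)) ∧
    (∀ (ΩA : QPB.DiffCalculus.{u₀, u₂, u₃} k A) (ΩH : QPB.DiffCalculus.{u₀, u₁, u₄} k H),
      ΩH.truncation.IsBicovariant →
      ∀ Δ₁ : QPB.CoactionLift ρ ΩA.truncation ΩH.truncation,
        QPB.IsBrzezinskiMajidBundle ρ ΩA.truncation ΩH.truncation ↔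
          QPB.horizontalBM ρ ΩA.truncation = QPB.horizontalD Δ₁) :=
  ⟨fun _ _ h => h.isFirstOrderComplete hρ.coaction, fun _ _ hH Δ₁ =>
    QPB.CoactionLift.isBrzezinskiMajidBundle_iff Δ₁ hρ.coaction hρ.galois.surjective hH⟩
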